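/- Let $\mathcal X,\mathcal Y,\Theta$ be Polish spaces with their Borel $\sigma$-algebras, with $\mathcal Y$ compact, and let $(\Omega,\mathcal F,\mathbb P)$ be a probability space. Write $\mathcal P(\Theta)$ for the set of Borel probability measures on $\Theta$. **Kernel.** Let $\nu_{\mathcal Y}$ be a measure on $\mathcal Y$ and let $\psi:\mathcal Y\times\Theta\to(0,\infty)$ be continuous with $\int_{\mathcal Y}\psi(y,\theta)\,d\nu_{\mathcal Y}(y)=1$ for every $\theta$. Suppose that for every $y_0\in\mathcal Y$ and $\varepsilon>0$ there are an open neighbourhood $U$ of $y_0$ and a compact $K\subset\Theta$ with $\psi(y,\theta)<\varepsilon$ for all $y\in U$, $\theta\notin K$. **Process.** For i.i.d. processes $\{V_{i,x}:x\in\mathcal X\}$, $i\ge1$, that are separable (in Doob's sense) and have marginals $V_{i,x}\sim\mathrm{Beta}(1,\alpha_x)$, $\alpha_x\ge 0$ ($\mathrm{Beta}(1,0)$ being the point mass at $1$), put $\pi_{i,x}=V_{i,x}\prod_{j<i}(1-V_{j,x})$. Let $G_x:\Omega\to\mathcal P(\Theta)$, $x\in\mathcal X$, be random probability measures of one of the following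 two types. * *(Single-atoms DDP.)* There are i.i.d. $\Theta$-valued random variables $\theta_i$ with law $G^0$, independent of the sequence $(V_i)$, such that almost surely $G_x=\sum_i\pi_{i,x}\delta_{\theta_i}$ for all $x$; and $G^0$ has full support on $\Theta$. * *(DDP.)* There are i.i.d. $\Theta$-valued processes $\{\theta_{i,x}:x\in\mathcal X\}$ with marginals $\theta_{i,x}\sim G^0_x$, jointly measurable in $(x,\omega)$ up to a null set of $\omega$, independent of the sequence $(V_i)$, such that almost surely $G_x=\sum_i\pi_{i,x}\delta_{\theta_{i,x}}$ for all $x$; and one of the following holds: (a) for every non-empty open $U\subset\Theta$ and compact $K\subset\mathcal X$, $\mathbb P(\theta_{1,x}\in U\ \forall x\in K)>0$; or (b) there is a measure $R$ on $\Theta$ with $G^0_x\ll R$ for all $x$, such that $\mathbb P(\theta_{1,x}\in A\ \forall x\in K)>0$ for every Borel $A$ with $R(A)>0$ and every compact $K\subset\mathcal X$. Suppose moreover that each $V_i$ has almost surely continuous sample paths, and that for every $\varepsilon>0$, every continuous $h:\mathcal X\to[0,1]$ and every compact $K\subset\mathcal X$, $\mathbb P(|V_{1,x}-h(x)|<\varepsilon\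 \forall x\in K)>0$. **Model.** Let $p^0$ be a probability density with respect to a $\sigma$-finite measure $\nu_{\mathcal X}$ on $\mathcal X$ (the density generating the predictors), and put $$m^\omega(y,x)=p^0(x)\int_\Theta\psi(y,\theta)\,dG^\omega_x(\theta).$$ Let $P^0:\mathcal X\to\mathcal P(\Theta)$ be strongly continuous, that is, $x\mapsto\int f\,dP^0_x$ is continuous for every bounded Borel $f:\Theta\to\mathbb R$; in case (b) suppose also $P^0_x\ll G^0_x$ for all $x$. Put $$m^0(y,x)=p^0(x)\int_\Theta\psi(y,\theta)\,dP^0_x(\theta).$$ **Theorem.** The function $m^0$ is a probability density with respect to $\nu_{\mathcal Y}\otimes\nu_{\mathcal X}$, and the posterior is weakly consistent at $m^0$: for almost every i.i.d. sequence $(y_1,x_1),(y_2,x_2),\dots$ from $m^0$, and for every neighbourhood $U$ of the law $m^0\,d(\nu_{\mathcal Y}\otimes\nu_{\mathcal X})$ in the weak topology on probability measures on $\mathcal Y\times\mathcal X$, $$\frac{\int_{\{\omega:\ m^\omega d(\nu_{\mathcal Y}\otimes\nu_{\mathcal X})\in U\}}\prod_{i=1}^n m^\omega(y_i,x_i)\,d\mathbb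 P(\omega)}{\int_\Omega\prod_{i=1}^n m^\omega(y_i,x_i)\,d\mathbb P(\omega)}\longrightarrow 1\qquad(n\to\infty).$$ -/

import Mathlib

open MeasureTheory ProbabilityTheory Filter Topology
open scoped ENNReal NNReal

namespace DepDirichlet

noncomputable section

/-- Stick-breaking weights `v i * ∏ j < i, (1 - v j)` (indices start at `0`). -/
def stickWeight (v : ℕ → ℝ) (i : ℕ) : ℝ :=
  v i * ∏ j ∈ Finset.range i, (1 - v j)

/-- The `Beta(1, a)` law on the line; `Beta(1, 0)` is the limiting law, the point mass at `1`. -/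
def betaOne (a : ℝ≥0) : Measure ℝ :=
  if a = 0 then Measure.dirac 1 else betaMeasure 1 a

/-- Doob separability of a real-valued process: outside one null set, any closed constraint that
holds along a countable set of indices inside an open set holds on the whole open set. -/
def IsSeparableProcess {X Ω : Type*} [TopologicalSpace X] [MeasurableSpace Ω]
    (P : Measure Ω) (V : X → Ω → ℝ) : Prop :=
  ∃ D : Set X, D.Countable ∧ ∀ᵐ ω ∂P, ∀ O : Set X, IsOpen O → ∀ F : Set ℝ, IsClosed F →
    (∀ x ∈ O ∩ D, V x ω ∈ F) → ∀ x ∈ O, V x ω ∈ F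

/-- Up to a null set of outcomes, the process is jointly measurable in the index and the outcome.
Measurable processes between Polish spaces with almost surely continuous paths are examples. -/
def IsJointlyMeasurable {X Ω S : Type*} [MeasurableSpace X] [MeasurableSpace Ω]
    [MeasurableSpace S] (P : Measure Ω) (Z : X → Ω → S) : Prop :=
  ∃ Z' : X → Ω → S, Measurable (fun p : X × Ω => Z' p.1 p.2) ∧ ∀ᵐ ω ∂P, ∀ x, Z x ω = Z' x ω

/-- The processes `{Z i x : x ∈ X}`, `i ∈ ℕ`, are independent and identically distributed,
as random elements of the product space `X → S`. -/
structure IsIIDProcesses {X Ω S : Type*} [MeasurableSpace Ω] [MeasurableSpace S]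
    (P : Measure Ω) (Z : ℕ → X → Ω → S) : Prop where
  measurable : ∀ i x, Measurable (Z i x)
  indep : iIndepFun (fun i (ω : Ω) (x : X) => Z i x ω) P
  ident : ∀ i, IdentDistrib (fun (ω : Ω) (x : X) => Z i x ω) (fun (ω : Ω) (x : X) => Z 0 x ω) P P

/-- The stick processes: i.i.d. separable processes with `Beta(1, α x)` marginals. -/
structure IsStickProcess {X Ω : Type*} [TopologicalSpace X] [MeasurableSpace Ω]
    (P : Measure Ω) (V : ℕ → X → Ω → ℝ) (α : X → ℝ≥0) : Prop where
  iid : IsIIDProcesses P V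
  separable : ∀ i, IsSeparableProcess P (V i)
  marginal : ∀ i x, P.map (V i x) = betaOne (α x)

/-- `G` is a dependent Dirichlet process with stick processes `V` and atom processes `θ`, whose
marginals are `G0 x`; the sticks are independent of the atoms. -/
structure IsDDP {X Θ Ω : Type*} [TopologicalSpace X] [MeasurableSpace Θ] [MeasurableSpace Ω]
    (P : Measure Ω) (V : ℕ → X → Ω → ℝ) (α : X → ℝ≥0)
    (θ : ℕ → X → Ω → Θ) (G0 : X → ProbabilityMeasure Θ)
    (G : X → Ω → ProbabilityMeasure Θ) : Prop where
  measurable : ∀ x, Measurable (G x)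
  sticks : IsStickProcess P V α
  atoms_iid : IsIIDProcesses P θ
  atoms_marginal : ∀ i x, P.map (θ i x) = (G0 x : Measure Θ)
  indep : IndepFun (fun (ω : Ω) (i : ℕ) (x : X) => V i x ω)
    (fun (ω : Ω) (i : ℕ) (x : X) => θ i x ω) P
  representation : ∀ᵐ ω ∂P, ∀ x, (G x ω : Measure Θ) =
    Measure.sum fun i =>
      ENNReal.ofReal (stickWeight (fun j => V j x ω) i) • Measure.dirac (θ i x ω)

/-- `G` is a single-atoms dependent Dirichlet process: the atoms `θ i` are i.i.d. random elements
of `Θ` with law `G0`, not depending on the predictor, and independent of the sticks. -/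
structure IsThetaDDP {X Θ Ω : Type*} [TopologicalSpace X] [MeasurableSpace Θ] [MeasurableSpace Ω]
    (P : Measure Ω) (V : ℕ → X → Ω → ℝ) (α : X → ℝ≥0)
    (θ : ℕ → Ω → Θ) (G0 : ProbabilityMeasure Θ)
    (G : X → Ω → ProbabilityMeasure Θ) : Prop where
  measurable : ∀ x, Measurable (G x)
  sticks : IsStickProcess P V α
  atoms_measurable : ∀ i, Measurable (θ i)
  atoms_indep : iIndepFun θ P
  atoms_law : ∀ i, P.map (θ i) = (G0 : Measure Θ)
  indep : IndepFun (fun (ω : Ω) (i : ℕ) (x : X) => V i x ω) (fun (ω : Ω) (i : ℕ) => θ i ω) P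
  representation : ∀ᵐ ω ∂P, ∀ x, (G x ω : Measure Θ) =
    Measure.sum fun i =>
      ENNReal.ofReal (stickWeight (fun j => V j x ω) i) • Measure.dirac (θ i ω)

/-- The atom condition of compact-weak type: the first atom process stays in any given non-empty
open set, over any given compact set of predictors, with positive probability. -/
def AtomsVisitOpenSets {X Θ Ω : Type*} [TopologicalSpace X] [TopologicalSpace Θ]
    [MeasurableSpace Ω] (P : Measure Ω) (θ : ℕ → X → Ω → Θ) : Prop :=
  ∀ U : Set Θ, IsOpen U → U.Nonempty → ∀ K : Set X, IsCompact K →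
    0 < P {ω | ∀ x ∈ K, θ 0 x ω ∈ U}

/-- The atom condition of compact-strong type: some measure `R` dominates all the marginals `G0 x`,
and the first atom process stays in any given set of positive `R`-measure, over any given compact
set of predictors, with positive probability. -/
def AtomsVisitPositiveSets {X Θ Ω : Type*} [TopologicalSpace X] [MeasurableSpace Θ]
    [MeasurableSpace Ω] (P : Measure Ω) (θ : ℕ → X → Ω → Θ)
    (G0 : X → ProbabilityMeasure Θ) : Prop :=
  ∃ R : Measure Θ, (∀ x, (G0 x : Measure Θ) ≪ R) ∧
    ∀ A : Set Θ, MeasurableSet A → 0 < R A → ∀ K : Set X, IsCompact K →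
      0 < P {ω | ∀ x ∈ K, θ 0 x ω ∈ A}

/-- `x ↦ P x` is strongly continuous: integrals of bounded measurable functions are continuous. -/
def StronglyContinuous {X Θ : Type*} [TopologicalSpace X] [MeasurableSpace Θ]
    (P : X → ProbabilityMeasure Θ) : Prop :=
  ∀ f : Θ → ℝ, Measurable f → (∃ C, ∀ t, |f t| ≤ C) →
    Continuous fun x => ∫ t, f t ∂(P x : Measure Θ)

/-- The kernel decays at infinity in the parameter, locally uniformly in the response. -/
def DecaysInParameter {Y Θ : Type*} [TopologicalSpace Y] [TopologicalSpace Θ]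
    (ψ : Y → Θ → ℝ≥0) : Prop :=
  ∀ y₀ : Y, ∀ ε : ℝ≥0, 0 < ε → ∃ U : Set Y, IsOpen U ∧ y₀ ∈ U ∧ ∃ K : Set Θ, IsCompact K ∧
    ∀ y ∈ U, ∀ t ∉ K, ψ y t < ε

/-- The joint density `p0 x * ∫ ψ(y, θ) dQ_x(θ)` of response and predictor at `(y, x)`. -/
def jointDensity {X Y Θ : Type*} [MeasurableSpace Θ] (p0 : X → ℝ≥0) (ψ : Y → Θ → ℝ≥0)
    (Q : X → ProbabilityMeasure Θ) (z : Y × X) : ℝ≥0∞ :=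
  p0 z.2 * ∫⁻ t, ψ z.1 t ∂(Q z.2 : Measure Θ)

/-- Bayes' formula: the posterior given the first `n` observations of the sample `z`, for the prior
`P` on `Ω` and the sampling densities `m ω`. -/
def posterior {Ω Z : Type*} [MeasurableSpace Ω] (P : Measure Ω) (m : Ω → Z → ℝ≥0∞)
    (n : ℕ) (z : ℕ → Z) : Measure Ω :=
  (∫⁻ ω, ∏ i ∈ Finset.range n, m ω (z i) ∂P)⁻¹ •
    P.withDensity fun ω => ∏ i ∈ Finset.range n, m ω (z i)

/-- Weak consistency at `m0` of the posterior for the random density `m ω` (with respect to the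
base measure `μ`), `ω ∼ P`: the density `m0` defines a probability measure `Q0`, and for almost
every i.i.d. sample from `Q0` the posterior mass of every weak neighbourhood of `Q0` tends to `1`. -/
def WeaklyConsistentAt {Ω Z : Type*} [MeasurableSpace Ω] [TopologicalSpace Z] [MeasurableSpace Z]
    [OpensMeasurableSpace Z] (μ : Measure Z) (P : Measure Ω) (m : Ω → Z → ℝ≥0∞)
    (m0 : Z → ℝ≥0∞) : Prop :=
  ∃ Q0 : ProbabilityMeasure Z, (Q0 : Measure Z) = μ.withDensity m0 ∧
    ∀ᵐ z ∂(Measure.infinitePi fun _ : ℕ => (Q0 : Measure Z)),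
      ∀ U ∈ 𝓝 Q0, Tendsto
        (fun n => posterior P m n z
          {ω | ∃ Q ∈ U, (Q : Measure Z) = μ.withDensity (m ω)}) atTop (𝓝 1)

end

end DepDirichlet

/-!
The posterior is weakly consistent because the prior charges every Kullback–Leibler ball around the
true law, which is Schwartz's criterion.

The hypotheses on the kernel force `Θ` to be compact. On the compact space `Y` the decay in the
parameter is uniform, so outside a large compact set of parameters the density `ψ(·, θ)` would have
total mass less than one (`DecaysInParameter.compactSpace`). Hence `ψ` takes values in some `[c, M]`
with `0 < c`, and all likelihood ratios `ρ ω = m ω / m0` take values in `[c / M, M / c]`.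

For such bounded ratios Schwartz's theorem (`ae_forall_nhds_tendsto_posterior`) has a short proof.
A weak neighbourhood is cut out by finitely many inequalities between integrals of bounded
functions `f`. The integrated likelihood over the set of densities violating one of them is
exponentially small: its expectation after tilting by `exp (-s ∑ f (z i))` is, and the tilt is
controlled by the law of large numbers. The full integrated likelihood decays more slowly than any
exponential, by Jensen's inequality on a small Kullback–Leibler ball and the law of large numbers
for the log-likelihood ratio averaged over that ball.

The Kullback–Leibler divergence of a bounded ratio is at most a multiple of the `L¹` distance, so
it is enough that with positive probability the mixtures of `ψ` under `G x` and under the true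
mixing measure are uniformly close for almost all `x` in a compact set
(`IsDDP.measure_ae_abs_integral_sub_le_pos`). Partition `Θ` into finitely many pieces on which `ψ`
varies little. The masses of the pieces under the true mixing measures are continuous in `x`, by
strong continuity, and up to a small factor they are the stick-breaking weights of continuous
sticks. With positive probability the first sticks are close to these and the first atoms lie in
the matching pieces. Because the atom processes have no path regularity, events over all `x` in a
compact set are not determined by the law of the process on the product space. They are replaced by
events along one fixed sequence of predictors, chosen so that a constraint along the sequence
implies the constraint at almost every predictor (`exists_seq_forall_mem_imp_ae_mem`); to these
events independence and equality in law apply.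
-/

namespace DepDirichlet

/-! ### Averages along an i.i.d. sample -/

lemma lintegral_prod_infinitePi {Z : Type*} [MeasurableSpace Z] (Q : Measure Z)
    [IsProbabilityMeasure Q] {F : Z → ℝ≥0∞} (hF : Measurable F) (n : ℕ) :
    ∫⁻ z, ∏ i ∈ Finset.range n, F (z i) ∂(Measure.infinitePi fun _ : ℕ => Q) =
      (∫⁻ z, F z ∂Q) ^ n := by
  rw [lintegral_prod_eq_prod_lintegral_of_indepFun (Finset.range n)
    (fun i (z : ℕ → Z) => F (z i)) (iIndepFun_infinitePi fun _ => hF) (by fun_prop)]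
  have h (i : ℕ) : ∫⁻ z, F (z i) ∂(Measure.infinitePi fun _ : ℕ => Q) = ∫⁻ z, F z ∂Q :=
    (measurePreserving_eval_infinitePi (fun _ : ℕ => Q) i).lintegral_comp hF
  simp [h]

lemma ae_tendsto_average_infinitePi {Z : Type*} [MeasurableSpace Z] (Q : Measure Z)
    [IsProbabilityMeasure Q] {f : Z → ℝ} (hf : Measurable f) {C : ℝ} (hC : ∀ z, |f z| ≤ C) :
    ∀ᵐ z ∂(Measure.infinitePi fun _ : ℕ => Q),
      Tendsto (fun n : ℕ => (∑ i ∈ Finset.range n, f (z i)) / n) atTop (𝓝 (∫ z, f z ∂Q)) := by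
  have hmp (i : ℕ) := measurePreserving_eval_infinitePi (fun _ : ℕ => Q) i
  have hfi (i : ℕ) : Measurable fun z : ℕ → Z => f (z i) := hf.comp (measurable_pi_apply i)
  have hid (i : ℕ) : IdentDistrib (fun z : ℕ → Z => f (z i)) (fun z : ℕ → Z => f (z 0))
      (Measure.infinitePi fun _ : ℕ => Q) (Measure.infinitePi fun _ : ℕ => Q) := by
    refine ⟨(hfi i).aemeasurable, (hfi 0).aemeasurable, ?_⟩
    have h (j : ℕ) : Measure.map (fun z : ℕ → Z => f (z j)) (Measure.infinitePi fun _ : ℕ => Q) =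
        Measure.map f Q := by
      conv_rhs => rw [← (hmp j).map_eq, Measure.map_map hf (hmp j).measurable]
      rfl
    rw [h i, h 0]
  have h := strong_law_ae_real (μ := Measure.infinitePi fun _ : ℕ => Q)
    (fun i (z : ℕ → Z) => f (z i))
    (Integrable.of_bound (hfi 0).aestronglyMeasurable C (Eventually.of_forall fun z => hC _))
    (fun i j hij => (iIndepFun_infinitePi (P := fun _ : ℕ => Q) (X := fun _ => f)
      fun _ => hf).indepFun hij) hid
  have hm : ∫ z, f (z 0) ∂(Measure.infinitePi fun _ : ℕ => Q) = ∫ z, f z ∂Q := by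
    conv_rhs => rw [← (hmp 0).map_eq,
      integral_map (hmp 0).measurable.aemeasurable hf.aestronglyMeasurable]
  rwa [hm] at h

/-! ### Schwartz's theorem for bounded likelihood ratios -/

/-- The Laplace transform of a bounded statistic under a density `r`. -/
lemma lintegral_density_mul_exp_le {Z : Type*} [MeasurableSpace Z] (Q : Measure Z)
    [IsProbabilityMeasure Q] {r f : Z → ℝ} (hr : Measurable r) (hf : Measurable f) {b C s : ℝ}
    (hr0 : ∀ z, 0 ≤ r z) (hrb : ∀ z, r z ≤ b) (hr1 : ∫ z, r z ∂Q = 1) (hC : ∀ z, |f z| ≤ C)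
    (hs : 0 ≤ s) (hsC : s * C ≤ 1) :
    ∫⁻ z, ENNReal.ofReal (r z) * ENNReal.ofReal (Real.exp (-s * f z)) ∂Q ≤
      ENNReal.ofReal (Real.exp (-s * ∫ z, f z * r z ∂Q + s ^ 2 * C ^ 2)) := by
  have hsf (z : Z) : |s * f z| ≤ s * C := by
    rw [abs_mul, abs_of_nonneg hs]; exact mul_le_mul_of_nonneg_left (hC z) hs
  have hexp (z : Z) : Real.exp (-s * f z) ≤ 1 - s * f z + s ^ 2 * C ^ 2 := by
    have h1 := Real.abs_exp_sub_one_sub_id_le (x := -s * f z) (by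
      rw [neg_mul, abs_neg]; exact (hsf z).trans hsC)
    have h2 : (-s * f z) ^ 2 ≤ s ^ 2 * C ^ 2 := by
      rw [neg_mul, neg_sq, ← mul_pow, ← sq_abs (s * f z)]
      exact pow_le_pow_left₀ (abs_nonneg _) (hsf z) 2
    linarith [(abs_le.1 h1).2]
  have hri : Integrable r Q := Integrable.of_bound (by fun_prop) b
    (Eventually.of_forall fun z => by rw [Real.norm_eq_abs, abs_of_nonneg (hr0 z)]; exact hrb z)
  have hfr : Integrable (fun z => f z * r z) Q := hri.bdd_mul (c := C) (by fun_prop)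
    (Eventually.of_forall fun z => by simpa using hC z)
  have hint : Integrable (fun z => r z * (1 - s * f z + s ^ 2 * C ^ 2)) Q := by
    have : (fun z => r z * (1 - s * f z + s ^ 2 * C ^ 2)) =
        fun z => (1 + s ^ 2 * C ^ 2) * r z - s * (f z * r z) := by ext z; ring
    rw [this]
    exact (hri.const_mul _).sub (hfr.const_mul _)
  have hval : ∫ z, r z * (1 - s * f z + s ^ 2 * C ^ 2) ∂Q =
      (-s * ∫ z, f z * r z ∂Q + s ^ 2 * C ^ 2) + 1 := by
    have : (fun z => r z * (1 - s * f z + s ^ 2 * C ^ 2)) =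
        fun z => (1 + s ^ 2 * C ^ 2) * r z - s * (f z * r z) := by ext z; ring
    rw [this, integral_sub (hri.const_mul _) (hfr.const_mul _), integral_const_mul,
      integral_const_mul, hr1]
    ring
  have hnn (z : Z) : 0 ≤ r z * (1 - s * f z + s ^ 2 * C ^ 2) :=
    mul_nonneg (hr0 z) ((Real.exp_pos _).le.trans (hexp z))
  calc ∫⁻ z, ENNReal.ofReal (r z) * ENNReal.ofReal (Real.exp (-s * f z)) ∂Q
      ≤ ∫⁻ z, ENNReal.ofReal (r z * (1 - s * f z + s ^ 2 * C ^ 2)) ∂Q := by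
        refine lintegral_mono fun z => ?_
        simp only
        rw [← ENNReal.ofReal_mul (hr0 z)]
        exact ENNReal.ofReal_le_ofReal (mul_le_mul_of_nonneg_left (hexp z) (hr0 z))
    _ = ENNReal.ofReal ((-s * ∫ z, f z * r z ∂Q + s ^ 2 * C ^ 2) + 1) := by
        rw [← ofReal_integral_eq_lintegral_ofReal hint (Eventually.of_forall hnn), hval]
    _ ≤ _ := ENNReal.ofReal_le_ofReal (Real.add_one_le_exp _)

/-- If the mean of `f` under every density `ρ ω`, `ω ∈ A`, exceeds the true mean by `δ`, then the
integrated likelihood over `A` decays exponentially along almost every sample: tilting by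
`exp (-s f)` makes the expected likelihood summable, and the tilt is controlled by the law of
large numbers. -/
lemma ae_eventually_setLIntegral_likelihood_le {Ω Z : Type*} [MeasurableSpace Ω]
    [MeasurableSpace Z] (P : Measure Ω) [IsProbabilityMeasure P] (Q : Measure Z)
    [IsProbabilityMeasure Q] {ρ : Ω → Z → ℝ} (hρ : Measurable fun p : Ω × Z => ρ p.1 p.2) {b : ℝ}
    (h0 : ∀ ω z, 0 ≤ ρ ω z) (hb : ∀ ω z, ρ ω z ≤ b) (h1 : ∀ ω, ∫ z, ρ ω z ∂Q = 1)
    {f : Z → ℝ} (hf : Measurable f) {C δ : ℝ} (hC : ∀ z, |f z| ≤ C) (hδ : 0 < δ)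
    {A : Set Ω} (hAf : ∀ ω ∈ A, ∫ z, f z ∂Q + δ ≤ ∫ z, f z * ρ ω z ∂Q) :
    ∃ κ : ℝ, 0 < κ ∧ ∀ᵐ z ∂(Measure.infinitePi fun _ : ℕ => Q), ∀ᶠ n : ℕ in atTop,
      ∫⁻ ω in A, ∏ i ∈ Finset.range n, ENNReal.ofReal (ρ ω (z i)) ∂P ≤
        ENNReal.ofReal (Real.exp (-κ * n)) := by
  -- a tilt small enough for the quadratic term of the Laplace transform to be a quarter of `s δ`
  obtain ⟨s, hs, hsC, hsκ⟩ : ∃ s : ℝ, 0 < s ∧ s * C ≤ 1 ∧ s ^ 2 * C ^ 2 ≤ s * δ / 4 := by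
    set D := |C| + 1 with hD
    have hD0 : 0 < D := by positivity
    have hCD : |C| ≤ D := by linarith
    refine ⟨min (1 / D) (δ / (4 * D ^ 2)), by positivity, ?_, ?_⟩
    · calc _ ≤ 1 / D * D := by
            refine mul_le_mul (min_le_left _ _) ((le_abs_self C).trans hCD) ?_ (by positivity)
            by_contra hneg
            exact hneg ((abs_nonneg _).trans (hC (Q.nonempty_of_neZero.some)))
        _ = 1 := by field_simp
    · set s := min (1 / D) (δ / (4 * D ^ 2))
      have hs0 : 0 < s := by positivity
      have h2 : C ^ 2 ≤ D ^ 2 := by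
        rw [← sq_abs]; exact pow_le_pow_left₀ (abs_nonneg _) hCD 2
      have h3 : s * D ^ 2 ≤ δ / 4 := by
        calc s * D ^ 2 ≤ δ / (4 * D ^ 2) * D ^ 2 :=
              mul_le_mul_of_nonneg_right (min_le_right _ _) (by positivity)
          _ = δ / 4 := by field_simp
      calc s ^ 2 * C ^ 2 ≤ s ^ 2 * D ^ 2 := by gcongr
        _ = s * (s * D ^ 2) := by ring
        _ ≤ s * (δ / 4) := by gcongr
        _ = s * δ / 4 := by ring
  obtain ⟨κ, hκdef⟩ : ∃ κ, κ = s * δ / 4 := ⟨_, rfl⟩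
  have hκ : 0 < κ := by rw [hκdef]; positivity
  set m := ∫ z, f z ∂Q with hm
  set S : Measure (ℕ → Z) := Measure.infinitePi fun _ : ℕ => Q with hS
  let T : ℕ → (ℕ → Z) → ℝ≥0∞ := fun n z =>
    ∫⁻ ω in A, ∏ i ∈ Finset.range n, ENNReal.ofReal (ρ ω (z i)) ∂P
  -- the tilted integrated likelihood, normalised so that its expectation is at most `exp (-κ n)`
  let W : ℕ → (ℕ → Z) → ℝ≥0∞ := fun n z =>
    ENNReal.ofReal (Real.exp (n * (s * m + 2 * κ))) * ∫⁻ ω in A, ∏ i ∈ Finset.range n,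
      (ENNReal.ofReal (ρ ω (z i)) * ENNReal.ofReal (Real.exp (-s * f (z i)))) ∂P
  have hρi (i : ℕ) : Measurable fun p : (ℕ → Z) × Ω => ρ p.2 (p.1 i) :=
    hρ.comp (by fun_prop : Measurable fun p : (ℕ → Z) × Ω => (p.2, p.1 i))
  have hρω (ω : Ω) : Measurable (ρ ω) :=
    hρ.comp (by fun_prop : Measurable fun z : Z => (ω, z))
  have hmeas (n : ℕ) : Measurable fun p : (ℕ → Z) × Ω => ∏ i ∈ Finset.range n,
      (ENNReal.ofReal (ρ p.2 (p.1 i)) * ENNReal.ofReal (Real.exp (-s * f (p.1 i)))) := by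
    fun_prop
  have hWm (n : ℕ) : Measurable (W n) :=
    ((hmeas n).lintegral_prod_right').const_mul _
  have hWint (n : ℕ) : ∫⁻ z, W n z ∂S ≤ ENNReal.ofReal (Real.exp (-κ)) ^ n := by
    calc ∫⁻ z, W n z ∂S
        = ENNReal.ofReal (Real.exp (n * (s * m + 2 * κ))) * ∫⁻ ω in A,
            (∫⁻ z, ENNReal.ofReal (ρ ω z) * ENNReal.ofReal (Real.exp (-s * f z)) ∂Q) ^ n ∂P := by
          simp only [W]
          rw [lintegral_const_mul _ ((hmeas n).lintegral_prod_right'),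
            lintegral_lintegral_swap (hmeas n).aemeasurable]
          congr 2 with ω
          have := hρω ω
          exact lintegral_prod_infinitePi Q (F := fun z => ENNReal.ofReal (ρ ω z) *
            ENNReal.ofReal (Real.exp (-s * f z))) (by fun_prop) n
      _ ≤ ENNReal.ofReal (Real.exp (n * (s * m + 2 * κ))) * ∫⁻ ω in A,
            ENNReal.ofReal (Real.exp (-s * (m + δ) + κ)) ^ n ∂P := by
          refine mul_le_mul_right (setLIntegral_mono measurable_const fun ω hω => ?_) _
          refine pow_le_pow_left' ?_ n
          refine (lintegral_density_mul_exp_le Q (hρω ω) hf (h0 ω) (hb ω) (h1 ω) hC hs.le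
            hsC).trans (ENNReal.ofReal_le_ofReal (Real.exp_le_exp.2 ?_))
          have := mul_le_mul_of_nonneg_left (hAf ω hω) hs.le
          rw [hκdef]; linarith
      _ ≤ ENNReal.ofReal (Real.exp (n * (s * m + 2 * κ))) *
            ENNReal.ofReal (Real.exp (-s * (m + δ) + κ)) ^ n := by
          refine mul_le_mul_right ?_ _
          rw [setLIntegral_const]
          exact mul_le_of_le_one_right' prob_le_one
      _ = ENNReal.ofReal (Real.exp (-κ)) ^ n := by
          rw [← ENNReal.ofReal_pow (Real.exp_pos _).le, ← ENNReal.ofReal_pow (Real.exp_pos _).le,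
            ← ENNReal.ofReal_mul (Real.exp_pos _).le, ← Real.exp_nat_mul, ← Real.exp_nat_mul,
            ← Real.exp_add]
          congr 2
          rw [hκdef]; ring
  have hsum : ∫⁻ z, ∑' n, W n z ∂S ≠ ∞ := by
    rw [lintegral_tsum fun n => (hWm n).aemeasurable]
    refine ne_top_of_le_ne_top ?_ (ENNReal.tsum_le_tsum hWint)
    rw [ENNReal.tsum_geometric]
    refine ENNReal.inv_ne_top.2 (tsub_pos_iff_lt.2 ?_).ne'
    rw [← ENNReal.ofReal_one]
    exact (ENNReal.ofReal_lt_ofReal_iff one_pos).2 (by simpa using hκ)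
  refine ⟨3 / 2 * κ, by positivity, ?_⟩
  filter_upwards [ae_lt_top (Measurable.tsum hWm) hsum,
    ae_tendsto_average_infinitePi Q hf hC] with z hz hz2
  have hW1 : ∀ᶠ n in atTop, W n z < 1 :=
    (ENNReal.tendsto_atTop_zero_of_tsum_ne_top hz.ne).eventually_lt_const one_pos
  have hav : ∀ᶠ n : ℕ in atTop, (∑ i ∈ Finset.range n, f (z i)) / n < m + κ / (2 * s) :=
    hz2.eventually_lt_const (by rw [← hm]; linarith [show 0 < κ / (2 * s) by positivity])
  filter_upwards [hW1, hav, eventually_gt_atTop 0] with n hn hn2 hn0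
  have hn0' : (0 : ℝ) < n := by exact_mod_cast hn0
  rw [div_lt_iff₀ hn0'] at hn2
  have hWeq : W n z = ENNReal.ofReal (Real.exp (n * (s * m + 2 * κ) -
      s * ∑ i ∈ Finset.range n, f (z i))) * T n z := by
    simp only [W, T, Finset.prod_mul_distrib]
    rw [lintegral_mul_const', mul_comm (∫⁻ _, _ ∂_), ← mul_assoc]
    · congr 1
      rw [← ENNReal.ofReal_prod_of_nonneg fun _ _ => (Real.exp_pos _).le,
        ← ENNReal.ofReal_mul (Real.exp_pos _).le, ← Real.exp_sum, ← Real.exp_add,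
        ← Finset.mul_sum]
      congr 2; ring
    · exact ENNReal.prod_ne_top fun _ _ => ENNReal.ofReal_ne_top
  have hTle : T n z ≤ (ENNReal.ofReal (Real.exp (n * (s * m + 2 * κ) -
      s * ∑ i ∈ Finset.range n, f (z i))))⁻¹ := by
    rw [ENNReal.le_inv_iff_mul_le, mul_comm, ← hWeq]
    exact hn.le
  refine hTle.trans ?_
  rw [← ENNReal.ofReal_inv_of_pos (Real.exp_pos _), ← Real.exp_neg]
  refine ENNReal.ofReal_le_ofReal (Real.exp_le_exp.2 ?_)
  have h5 := mul_le_mul_of_nonneg_left hn2.le hs.le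
  have h6 : s * ((m + κ / (2 * s)) * n) = (s * m + κ / 2) * n := by field_simp
  rw [h6] at h5
  nlinarith

/-- If the prior charges every Kullback–Leibler ball around the true law, the integrated likelihood
decays subexponentially along almost every sample: Jensen's inequality on a Kullback–Leibler ball
reduces this to the law of large numbers for a single function. -/
lemma ae_eventually_le_lintegral_likelihood {Ω Z : Type*} [MeasurableSpace Ω]
    [MeasurableSpace Z] (P : Measure Ω) [IsProbabilityMeasure P] (Q : Measure Z)
    [IsProbabilityMeasure Q] {ρ : Ω → Z → ℝ} (hρ : Measurable fun p : Ω × Z => ρ p.1 p.2)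
    {a b : ℝ} (ha : 0 < a) (hab : ∀ ω z, a ≤ ρ ω z) (hb : ∀ ω z, ρ ω z ≤ b) {κ : ℝ} (hκ : 0 < κ)
    (hKL : 0 < P {ω | ∫ z, -Real.log (ρ ω z) ∂Q < κ}) :
    ∃ c : ℝ, 0 < c ∧ ∀ᵐ z ∂(Measure.infinitePi fun _ : ℕ => Q), ∀ᶠ n : ℕ in atTop,
      ENNReal.ofReal (c * Real.exp (-(2 * κ) * n)) ≤
        ∫⁻ ω, ∏ i ∈ Finset.range n, ENNReal.ofReal (ρ ω (z i)) ∂P := by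
  have hpos (ω : Ω) (z : Z) : 0 < ρ ω z := ha.trans_le (hab ω z)
  set B : Set Ω := {ω | ∫ z, -Real.log (ρ ω z) ∂Q < κ} with hB
  have hlog : Measurable fun p : Ω × Z => Real.log (ρ p.1 p.2) := hρ.log
  have hBm : MeasurableSet B := by
    refine measurableSet_lt (StronglyMeasurable.measurable ?_) measurable_const
    exact hlog.neg.stronglyMeasurable.integral_prod_right'
  obtain ⟨C, hC⟩ : ∃ C, ∀ ω z, |Real.log (ρ ω z)| ≤ C := by
    refine ⟨max (Real.log b) (-Real.log a), fun ω z => abs_le.2 ⟨?_, ?_⟩⟩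
    · have := Real.log_le_log ha (hab ω z)
      linarith [le_max_right (Real.log b) (-Real.log a)]
    · exact (Real.log_le_log (hpos ω z) (hb ω z)).trans (le_max_left _ _)
  set p : ℝ := P.real B with hp
  have hp0 : 0 < p := ENNReal.toReal_pos hKL.ne' (measure_ne_top _ _)
  have hlogi (z : Z) : Integrable (fun ω => Real.log (ρ ω z)) (P.restrict B) := by
    have : Measurable fun ω => ρ ω z := hρ.comp (by fun_prop : Measurable fun ω : Ω => (ω, z))
    exact Integrable.of_bound this.log.aestronglyMeasurable C
      (Eventually.of_forall fun ω => hC ω z)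
  -- the average over `B` of the log-likelihood ratio
  set g : Z → ℝ := fun z => p⁻¹ * ∫ ω in B, Real.log (ρ ω z) ∂P with hg
  have hgm : Measurable g := by
    refine Measurable.const_mul (StronglyMeasurable.measurable ?_) _
    exact hlog.stronglyMeasurable.integral_prod_left'
  have hgb (z : Z) : |g z| ≤ p⁻¹ * (C * p) := by
    rw [hg, abs_mul, abs_of_pos (inv_pos.2 hp0)]
    refine mul_le_mul_of_nonneg_left ?_ (inv_pos.2 hp0).le
    have := norm_integral_le_of_norm_le_const (μ := P.restrict B) (f := fun ω => Real.log (ρ ω z))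
      (C := C) (Eventually.of_forall fun ω => hC ω z)
    simpa [hp, measureReal_restrict_apply_univ] using this
  have hgint : -κ ≤ ∫ z, g z ∂Q := by
    have hswap : ∫ z, ∫ ω in B, Real.log (ρ ω z) ∂P ∂Q =
        ∫ ω in B, ∫ z, Real.log (ρ ω z) ∂Q ∂P := by
      refine integral_integral_swap (f := fun z ω => Real.log (ρ ω z)) ?_
      exact Integrable.of_bound (hlog.comp measurable_swap).aestronglyMeasurable C
        (Eventually.of_forall fun q => hC q.2 q.1)
    have hlow : -κ * p ≤ ∫ ω in B, ∫ z, Real.log (ρ ω z) ∂Q ∂P := by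
      have hconst : -κ * p = ∫ _ in B, -κ ∂P := by
        rw [setIntegral_const, smul_eq_mul, mul_comm]
      rw [hconst]
      refine setIntegral_mono_on (integrable_const _) ?_ hBm fun ω hω => ?_
      · refine Integrable.of_bound
          (hlog.stronglyMeasurable.integral_prod_right').aestronglyMeasurable C
          (Eventually.of_forall fun ω => ?_)
        simpa using norm_integral_le_of_norm_le_const (μ := Q) (f := fun z => Real.log (ρ ω z))
          (Eventually.of_forall fun z => hC ω z)
      · have : ∫ z, -Real.log (ρ ω z) ∂Q < κ := hω
        rw [integral_neg] at this
        linarith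
    rw [hg, integral_const_mul, hswap]
    calc -κ = p⁻¹ * (-κ * p) := by field_simp
      _ ≤ _ := mul_le_mul_of_nonneg_left hlow (inv_pos.2 hp0).le
  refine ⟨p, hp0, ?_⟩
  filter_upwards [ae_tendsto_average_infinitePi Q hgm hgb] with z hz
  have hav : ∀ᶠ n : ℕ in atTop, -(2 * κ) < (∑ i ∈ Finset.range n, g (z i)) / n :=
    hz.eventually_const_lt (by linarith)
  filter_upwards [hav, eventually_gt_atTop 0] with n hn hn0
  have hn0' : (0 : ℝ) < n := by exact_mod_cast hn0
  rw [lt_div_iff₀ hn0'] at hn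
  set u : Ω → ℝ := fun ω => ∑ i ∈ Finset.range n, Real.log (ρ ω (z i)) with hu
  have hui : Integrable u (P.restrict B) := integrable_finsetSum _ fun i _ => hlogi (z i)
  set v : ℝ := ∑ i ∈ Finset.range n, g (z i) with hv
  have huint : ∫ ω in B, u ω ∂P = p * v := by
    rw [hu, integral_finsetSum _ fun i _ => hlogi (z i), hv, hg, ← Finset.mul_sum,
      mul_inv_cancel_left₀ hp0.ne']
  -- Jensen's inequality for `exp`, in the form of the tangent at `v`
  have htan (ω : Ω) : Real.exp v * (1 + u ω - v) ≤ Real.exp (u ω) := by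
    have h1 := Real.add_one_le_exp (u ω - v)
    calc Real.exp v * (1 + u ω - v) ≤ Real.exp v * Real.exp (u ω - v) :=
          mul_le_mul_of_nonneg_left (by linarith) (Real.exp_pos _).le
      _ = Real.exp (u ω) := by rw [← Real.exp_add]; ring_nf
  have hlini : Integrable (fun ω => Real.exp v * (1 + u ω - v)) (P.restrict B) :=
    (((integrable_const _).add hui).sub (integrable_const _)).const_mul _
  have hlin : ∫ ω in B, Real.exp v * (1 + u ω - v) ∂P = p * Real.exp v := by
    have : (fun ω => 1 + u ω - v) = fun ω => (1 - v) + u ω := by ext ω; ring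
    rw [integral_const_mul, this, integral_add (integrable_const _) hui, huint,
      setIntegral_const, smul_eq_mul]
    simp only [← hp]; ring
  calc ENNReal.ofReal (p * Real.exp (-(2 * κ) * n))
      ≤ ENNReal.ofReal (p * Real.exp v) := by gcongr
    _ = ENNReal.ofReal (∫ ω in B, Real.exp v * (1 + u ω - v) ∂P) := by rw [hlin]
    _ ≤ ENNReal.ofReal (∫ ω in B, max (Real.exp v * (1 + u ω - v)) 0 ∂P) :=
        ENNReal.ofReal_le_ofReal (integral_mono hlini hlini.pos_part fun _ => le_max_left _ _)
    _ = ∫⁻ ω in B, ENNReal.ofReal (max (Real.exp v * (1 + u ω - v)) 0) ∂P :=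
        ofReal_integral_eq_lintegral_ofReal hlini.pos_part
          (Eventually.of_forall fun _ => le_max_right _ _)
    _ ≤ ∫⁻ ω in B, ∏ i ∈ Finset.range n, ENNReal.ofReal (ρ ω (z i)) ∂P := by
        refine lintegral_mono fun ω => ?_
        simp only
        rw [← ENNReal.ofReal_prod_of_nonneg fun i _ => (hpos ω (z i)).le]
        refine ENNReal.ofReal_le_ofReal
          ((max_le (htan ω) (Real.exp_pos _).le).trans (le_of_eq ?_))
        rw [hu, Real.exp_sum]
        exact Finset.prod_congr rfl fun i _ => Real.exp_log (hpos ω (z i))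
    _ ≤ _ := setLIntegral_le_lintegral _ _

lemma posterior_apply {Ω Z : Type*} [MeasurableSpace Ω] (P : Measure Ω) [SFinite P]
    (m : Ω → Z → ℝ≥0∞) (n : ℕ) (z : ℕ → Z) (A : Set Ω) :
    posterior P m n z A = (∫⁻ ω, ∏ i ∈ Finset.range n, m ω (z i) ∂P)⁻¹ *
      ∫⁻ ω in A, ∏ i ∈ Finset.range n, m ω (z i) ∂P := by
  rw [posterior, Measure.smul_apply, smul_eq_mul, withDensity_apply' _ A]

/-- The posterior asymptotically rejects densities that give too large a mean to a bounded
statistic. -/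
lemma ae_tendsto_posterior_zero {Ω Z : Type*} [MeasurableSpace Ω]
    [MeasurableSpace Z] (P : Measure Ω) [IsProbabilityMeasure P] (Q : Measure Z)
    [IsProbabilityMeasure Q] {ρ : Ω → Z → ℝ} (hρ : Measurable fun p : Ω × Z => ρ p.1 p.2)
    {a b : ℝ} (ha : 0 < a) (hab : ∀ ω z, a ≤ ρ ω z) (hb : ∀ ω z, ρ ω z ≤ b)
    (h1 : ∀ ω, ∫ z, ρ ω z ∂Q = 1)
    (hKL : ∀ ε : ℝ, 0 < ε → 0 < P {ω | ∫ z, -Real.log (ρ ω z) ∂Q < ε})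
    {f : Z → ℝ} (hf : Measurable f) {C δ : ℝ} (hC : ∀ z, |f z| ≤ C) (hδ : 0 < δ)
    {A : Set Ω} (hAf : ∀ ω ∈ A, ∫ z, f z ∂Q + δ ≤ ∫ z, f z * ρ ω z ∂Q) :
    ∀ᵐ z ∂(Measure.infinitePi fun _ : ℕ => Q),
      Tendsto (fun n => posterior P (fun ω z => ENNReal.ofReal (ρ ω z)) n z A) atTop (𝓝 0) := by
  obtain ⟨κ, hκ, hnum⟩ := ae_eventually_setLIntegral_likelihood_le P Q hρ
    (fun ω z => ha.le.trans (hab ω z)) hb h1 hf hC hδ hAf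
  obtain ⟨c, hc, hden⟩ := ae_eventually_le_lintegral_likelihood P Q hρ ha hab hb
    (κ := κ / 4) (by positivity) (hKL _ (by positivity))
  filter_upwards [hnum, hden] with z hz1 hz2
  have hlim : Tendsto (fun n : ℕ => ENNReal.ofReal (c⁻¹ * Real.exp (-(κ / 2) * n))) atTop
      (𝓝 0) := by
    rw [← ENNReal.ofReal_zero]
    refine (ENNReal.continuous_ofReal.tendsto 0).comp ?_
    rw [← mul_zero c⁻¹]
    refine Tendsto.const_mul _ (Real.tendsto_exp_atBot.comp ?_)
    exact tendsto_natCast_atTop_atTop.const_mul_atTop_of_neg (by linarith)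
  refine tendsto_of_tendsto_of_tendsto_of_le_of_le' tendsto_const_nhds hlim
    (Eventually.of_forall fun _ => zero_le) ?_
  filter_upwards [hz1, hz2] with n hn1 hn2
  rw [posterior_apply]
  calc _ ≤ (ENNReal.ofReal (c * Real.exp (-(2 * (κ / 4)) * n)))⁻¹ *
        ENNReal.ofReal (Real.exp (-κ * n)) := mul_le_mul' (ENNReal.inv_le_inv.2 hn2) hn1
    _ = ENNReal.ofReal (c⁻¹ * Real.exp (-(κ / 2) * n)) := by
      rw [← ENNReal.ofReal_inv_of_pos (by positivity), ← ENNReal.ofReal_mul (by positivity),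
        mul_inv, mul_assoc, ← Real.exp_neg, ← Real.exp_add]
      congr 3; ring

/-- **Schwartz's theorem** for likelihood ratios `ρ ω` bounded away from `0` and `∞`: if the prior
charges every Kullback–Leibler ball around the true law `Q`, then the posterior is weakly consistent
at `Q`. -/
theorem ae_forall_nhds_tendsto_posterior {Ω Z : Type*} [MeasurableSpace Ω] [TopologicalSpace Z]
    [PolishSpace Z] [MeasurableSpace Z] [BorelSpace Z] (P : Measure Ω) [IsProbabilityMeasure P]
    (Q : ProbabilityMeasure Z) {ρ : Ω → Z → ℝ} (hρ : Measurable fun p : Ω × Z => ρ p.1 p.2)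
    {a b : ℝ} (ha : 0 < a) (hab : ∀ ω z, a ≤ ρ ω z) (hb : ∀ ω z, ρ ω z ≤ b)
    (h1 : ∀ ω, ∫ z, ρ ω z ∂(Q : Measure Z) = 1)
    (hKL : ∀ ε : ℝ, 0 < ε → 0 < P {ω | ∫ z, -Real.log (ρ ω z) ∂(Q : Measure Z) < ε}) :
    ∀ᵐ z ∂(Measure.infinitePi fun _ : ℕ => (Q : Measure Z)), ∀ U ∈ 𝓝 Q, Tendsto
      (fun n => posterior P (fun ω z => ENNReal.ofReal (ρ ω z)) n z
        {ω | ∃ Q' ∈ U, (Q' : Measure Z) =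
          (Q : Measure Z).withDensity fun z => ENNReal.ofReal (ρ ω z)}) atTop (𝓝 1) := by
  have hpos (ω : Ω) (z : Z) : 0 < ρ ω z := ha.trans_le (hab ω z)
  have hρω (ω : Ω) : Measurable (ρ ω) := hρ.comp (by fun_prop : Measurable fun z : Z => (ω, z))
  have hρz (z : Z) : Measurable fun ω => ρ ω z :=
    hρ.comp (by fun_prop : Measurable fun ω : Ω => (ω, z))
  have hρi (ω : Ω) : Integrable (ρ ω) (Q : Measure Z) :=
    Integrable.of_bound (hρω ω).aestronglyMeasurable b (Eventually.of_forall fun z => by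
      rw [Real.norm_eq_abs, abs_of_pos (hpos ω z)]; exact hb ω z)
  let R : Ω → ProbabilityMeasure Z := fun ω =>
    ⟨(Q : Measure Z).withDensity fun z => ENNReal.ofReal (ρ ω z), ⟨by
      rw [withDensity_apply _ MeasurableSet.univ, setLIntegral_univ,
        ← ofReal_integral_eq_lintegral_ofReal (hρi ω)
          (Eventually.of_forall fun z => (hpos ω z).le), h1 ω, ENNReal.ofReal_one]⟩⟩
  have hRint (ω : Ω) (f : BoundedContinuousFunction Z ℝ) :
      ∫ z, f z ∂(R ω : Measure Z) = ∫ z, f z * ρ ω z ∂(Q : Measure Z) := by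
    change ∫ z, f z ∂((Q : Measure Z).withDensity fun z => ENNReal.ofReal (ρ ω z)) = _
    rw [integral_withDensity_eq_integral_toReal_smul (hρω ω).ennreal_ofReal
      (Eventually.of_forall fun z => ENNReal.ofReal_lt_top)]
    refine integral_congr_ae (Eventually.of_forall fun z => ?_)
    simp only [smul_eq_mul]
    rw [ENNReal.toReal_ofReal (hpos ω z).le, mul_comm]
  have hset (U : Set (ProbabilityMeasure Z)) : {ω | ∃ Q' ∈ U, (Q' : Measure Z) =
      (Q : Measure Z).withDensity fun z => ENNReal.ofReal (ρ ω z)} = {ω | R ω ∈ U} := by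
    ext ω
    constructor
    · rintro ⟨Q', hQ', h⟩
      have : R ω = Q' := (Subtype.ext h).symm
      change R ω ∈ U
      rwa [this]
    · exact fun h => ⟨R ω, h, rfl⟩
  set post : ℕ → (ℕ → Z) → Measure Ω :=
    posterior P (fun ω z => ENNReal.ofReal (ρ ω z)) with hpost
  -- the complement of a weak neighbourhood has vanishing posterior mass
  have hone (U : Set (ProbabilityMeasure Z)) (hU : U ∈ 𝓝 Q) :
      ∀ᵐ z ∂(Measure.infinitePi fun _ : ℕ => (Q : Measure Z)),
        Tendsto (fun n => post n z {ω | R ω ∉ U}) atTop (𝓝 0) := by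
    have hle : (⨅ f : BoundedContinuousFunction Z ℝ,
        comap (fun Q' : ProbabilityMeasure Z => ∫ z, f z ∂(Q' : Measure Z))
          (𝓝 (∫ z, f z ∂(Q : Measure Z)))) ≤ 𝓝 Q := by
      rw [← tendsto_id', ProbabilityMeasure.tendsto_iff_forall_integral_tendsto]
      exact fun f => tendsto_iff_comap.2 (iInf_le _ f)
    refine iInf_sets_induct (hle hU) (by simp) ?_
    intro f s₁ s₂ hs₁ hs₂
    obtain ⟨t, ht, hts⟩ := mem_comap.1 hs₁
    obtain ⟨δ, hδ, hδt⟩ := Metric.mem_nhds_iff.1 ht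
    have hfC (z : Z) : |f z| ≤ ‖f‖ := f.norm_coe_le_norm z
    have hup := ae_tendsto_posterior_zero P (Q : Measure Z) hρ ha hab hb h1 hKL
      (f := fun z => f z) f.continuous.measurable hfC hδ
      (A := {ω | ∫ z, f z ∂(Q : Measure Z) + δ ≤ ∫ z, f z * ρ ω z ∂(Q : Measure Z)})
      fun ω hω => hω
    have hdown := ae_tendsto_posterior_zero P (Q : Measure Z) hρ ha hab hb h1 hKL
      (f := fun z => -f z) f.continuous.measurable.neg (fun z => by rw [abs_neg]; exact hfC z) hδ
      (A := {ω | ∫ z, -f z ∂(Q : Measure Z) + δ ≤ ∫ z, -f z * ρ ω z ∂(Q : Measure Z)})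
      fun ω hω => hω
    filter_upwards [hs₂, hup, hdown] with z hz hz1 hz2
    have hsum := (hz1.add hz2).add hz
    simp only [add_zero] at hsum
    refine tendsto_of_tendsto_of_tendsto_of_le_of_le tendsto_const_nhds hsum
      (fun _ => zero_le) fun n => ?_
    refine (measure_mono fun ω hω => ?_).trans
      ((measure_union_le _ _).trans (add_le_add_left (measure_union_le _ _) _))
    by_contra hcon
    simp only [Set.mem_union, Set.mem_ofPred_eq, not_or, not_le, not_not, neg_mul,
      integral_neg] at hcon
    refine hω ⟨hts (hδt ?_), hcon.2⟩
    change dist (∫ z, f z ∂(R ω : Measure Z)) _ < δ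
    rw [Real.dist_eq, hRint, abs_lt]
    constructor <;> linarith [hcon.1.1, hcon.1.2]
  have hprob (n : ℕ) (z : ℕ → Z) : post n z Set.univ = 1 := by
    rw [hpost, posterior_apply, setLIntegral_univ]
    have hmeas : Measurable fun ω => ∏ i ∈ Finset.range n, ENNReal.ofReal (ρ ω (z i)) :=
      Finset.measurable_prod _ fun i _ => (hρz (z i)).ennreal_ofReal
    refine ENNReal.inv_mul_cancel ?_ ?_
    · rw [← pos_iff_ne_zero, lintegral_pos_iff_support hmeas]
      have : Function.support (fun ω => ∏ i ∈ Finset.range n, ENNReal.ofReal (ρ ω (z i))) =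
          Set.univ := by
        ext ω
        simp only [Function.mem_support, Set.mem_univ, iff_true]
        exact Finset.prod_ne_zero_iff.2 fun i _ => (ENNReal.ofReal_pos.2 (hpos ω (z i))).ne'
      rw [this, measure_univ]
      exact one_pos
    · refine ne_top_of_le_ne_top ?_ (lintegral_mono (g := fun _ => ENNReal.ofReal b ^ n)
        fun ω => ?_)
      · rw [lintegral_const, measure_univ, mul_one]
        exact ENNReal.pow_ne_top ENNReal.ofReal_ne_top
      · refine (Finset.prod_le_prod' fun i _ => ENNReal.ofReal_le_ofReal (hb ω (z i))).trans ?_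
        simp
  -- the weak topology is metrizable, so one null set serves all neighbourhoods
  obtain ⟨B, hB⟩ := (𝓝 Q).exists_antitone_basis
  have hall : ∀ᵐ z ∂(Measure.infinitePi fun _ : ℕ => (Q : Measure Z)), ∀ k,
      Tendsto (fun n => post n z {ω | R ω ∉ B k}) atTop (𝓝 0) :=
    ae_all_iff.2 fun k => hone _ (hB.mem k)
  filter_upwards [hall] with z hz U hU
  obtain ⟨k, hk⟩ := hB.mem_iff.1 hU
  rw [hset]
  have hlow : Tendsto (fun n => 1 - post n z {ω | R ω ∉ B k}) atTop (𝓝 1) := by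
    have := ENNReal.Tendsto.sub (tendsto_const_nhds (x := (1 : ℝ≥0∞))) (hz k)
      (Or.inl ENNReal.one_ne_top)
    simpa using this
  refine tendsto_of_tendsto_of_tendsto_of_le_of_le hlow tendsto_const_nhds (fun n => ?_)
    fun n => ?_
  · simp only
    rw [tsub_le_iff_right, ← hprob n z]
    refine (measure_mono fun ω _ => ?_).trans (measure_union_le _ _)
    by_cases h : R ω ∈ B k
    · exact Or.inl (hk h)
    · exact Or.inr h
  · exact (measure_mono (Set.subset_univ _)).trans (hprob n z).le

/-- Only the likelihood ratios matter for the posterior: if almost every random density is `m0`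
times a likelihood ratio `ρ ω`, Schwartz's theorem for `ρ` gives weak consistency at `m0`. -/
theorem weaklyConsistentAt_of_likelihoodRatio {Ω Z : Type*} [MeasurableSpace Ω]
    [TopologicalSpace Z] [PolishSpace Z] [MeasurableSpace Z] [BorelSpace Z] (μ : Measure Z)
    (P : Measure Ω) [IsProbabilityMeasure P] {m : Ω → Z → ℝ≥0∞} {m0 : Z → ℝ≥0∞}
    (hm0 : Measurable m0) (hm0_top : ∀ z, m0 z ≠ ∞) (hm0_one : ∫⁻ z, m0 z ∂μ = 1)
    {ρ : Ω → Z → ℝ} (hρ : Measurable fun p : Ω × Z => ρ p.1 p.2)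
    (hm : ∀ᵐ ω ∂P, ∀ z, m ω z = m0 z * ENNReal.ofReal (ρ ω z))
    {a b : ℝ} (ha : 0 < a) (hab : ∀ ω z, a ≤ ρ ω z) (hb : ∀ ω z, ρ ω z ≤ b)
    (h1 : ∀ ω, ∫ z, ρ ω z ∂(μ.withDensity m0) = 1)
    (hKL : ∀ ε : ℝ, 0 < ε → 0 < P {ω | ∫ z, -Real.log (ρ ω z) ∂(μ.withDensity m0) < ε}) :
    WeaklyConsistentAt μ P m m0 := by
  obtain ⟨Q, hQ⟩ : ∃ Q : ProbabilityMeasure Z, (Q : Measure Z) = μ.withDensity m0 :=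
    ⟨⟨μ.withDensity m0, ⟨by
      rw [withDensity_apply _ MeasurableSet.univ, setLIntegral_univ, hm0_one]⟩⟩, rfl⟩
  refine ⟨Q, hQ, ?_⟩
  rw [← hQ] at h1
  simp only [← hQ] at hKL
  have hpos : ∀ᵐ z ∂(Measure.infinitePi fun _ : ℕ => (Q : Measure Z)), ∀ i, m0 (z i) ≠ 0 := by
    refine ae_all_iff.2 fun i => ?_
    refine (measurePreserving_eval_infinitePi (fun _ : ℕ => (Q : Measure Z))
      i).quasiMeasurePreserving.ae (p := fun z => m0 z ≠ 0) ?_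
    rw [hQ, ae_withDensity_iff hm0]
    exact Eventually.of_forall fun _ h => h
  filter_upwards [hpos, ae_forall_nhds_tendsto_posterior P Q hρ ha hab hb
    h1 hKL] with z hz hz2 U hU
  refine (hz2 U hU).congr fun n => ?_
  have hset : {ω | ∃ Q' ∈ U, (Q' : Measure Z) =
      (Q : Measure Z).withDensity fun z => ENNReal.ofReal (ρ ω z)} =ᵐ[P]
      {ω | ∃ Q' ∈ U, (Q' : Measure Z) = μ.withDensity (m ω)} := by
    filter_upwards [hm] with ω hω
    have hρω : Measurable fun z => ENNReal.ofReal (ρ ω z) :=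
      (hρ.comp (by fun_prop : Measurable fun z : Z => (ω, z))).ennreal_ofReal
    have : m ω = m0 * fun z => ENNReal.ofReal (ρ ω z) := funext hω
    refine propext ?_
    change (∃ Q' ∈ U, _) ↔ (∃ Q' ∈ U, _)
    rw [this, withDensity_mul μ hm0 hρω, hQ]
  set c : ℝ≥0∞ := ∏ i ∈ Finset.range n, m0 (z i) with hc
  have hc0 : c ≠ 0 := Finset.prod_ne_zero_iff.2 fun i _ => hz i
  have hct : c ≠ ∞ := ENNReal.prod_ne_top fun i _ => hm0_top _
  have hprod : (fun ω => ∏ i ∈ Finset.range n, m ω (z i)) =ᵐ[P]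
      fun ω => c * ∏ i ∈ Finset.range n, ENNReal.ofReal (ρ ω (z i)) := by
    filter_upwards [hm] with ω hω
    rw [hc, ← Finset.prod_mul_distrib]
    exact Finset.prod_congr rfl fun i _ => hω _
  rw [posterior_apply, posterior_apply, lintegral_congr_ae hprod,
    setLIntegral_congr hset, lintegral_congr_ae (ae_restrict_of_ae hprod),
    lintegral_const_mul' _ _ hct, lintegral_const_mul' _ _ hct,
    ENNReal.mul_inv (Or.inl hc0) (Or.inl hct), mul_mul_mul_comm, ENNReal.inv_mul_cancel hc0 hct,
    one_mul]

/-! ### Jointly measurable processes along a countable set of indices -/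

lemma infinitePi_forall_mem_eq_zero {X : Type*} [MeasurableSpace X] (μ : Measure X)
    [IsProbabilityMeasure μ] {s : Set X} (hs : MeasurableSet s) (h : μ s < 1) :
    (Measure.infinitePi fun _ : ℕ => μ) {ξ | ∀ l, ξ l ∈ s} = 0 := by
  have hle (n : ℕ) : (Measure.infinitePi fun _ : ℕ => μ) {ξ | ∀ l, ξ l ∈ s} ≤ μ s ^ n := by
    have := Measure.infinitePi_pi (fun _ : ℕ => μ) (s := Finset.range n) (t := fun _ => s)
      fun _ _ => hs
    rw [Finset.prod_const, Finset.card_range] at this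
    rw [← this]
    exact measure_mono fun ξ hξ l _ => hξ l
  exact le_antisymm (ge_of_tendsto' (ENNReal.tendsto_pow_atTop_nhds_zero_of_lt_one h) hle) zero_le

/-- A constraint on the paths of countably many jointly measurable processes can be tested, up to
null sets of indices and outcomes, along a fixed sequence of indices. Almost every i.i.d. sample
from `μ` is such a sequence: a path violating the constraint on a set of positive measure is
caught by the sample. -/
lemma exists_seq_forall_mem_imp_ae_mem {X Ω S : Type*} [MeasurableSpace X] [MeasurableSpace Ω]
    [MeasurableSpace S] (P : Measure Ω) [IsProbabilityMeasure P] (μ : Measure X)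
    [IsProbabilityMeasure μ] {Z : ℕ → X → Ω → S} (hZ : ∀ i, IsJointlyMeasurable P (Z i))
    {B : ℕ → Set (X × S)} (hB : ∀ i, MeasurableSet (B i)) :
    ∃ ξ : ℕ → X, ∀ᵐ ω ∂P, ∀ i, (∀ l, (ξ l, Z i (ξ l) ω) ∈ B i) →
      ∀ᵐ x ∂μ, (x, Z i x ω) ∈ B i := by
  choose Z' hZ' hZZ' using hZ
  have hm (i : ℕ) : MeasurableSet {q : Ω × X | (q.2, Z' i q.2 q.1) ∈ B i} := by
    refine (measurable_snd.prodMk ((hZ' i).comp measurable_swap)) (hB i)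
  have key (i : ℕ) : ∀ᵐ ξ ∂(Measure.infinitePi fun _ : ℕ => μ), ∀ᵐ ω ∂P,
      (∀ l, (ξ l, Z' i (ξ l) ω) ∈ B i) → μ {x | (x, Z' i x ω) ∉ B i} = 0 := by
    have hN : Measurable fun ω => μ {x | (x, Z' i x ω) ∉ B i} :=
      measurable_measure_prodMk_left (hm i).compl
    have hset : MeasurableSet {q : Ω × (ℕ → X) | (∀ l, (q.2 l, Z' i (q.2 l) q.1) ∈ B i) →
        μ {x | (x, Z' i x q.1) ∉ B i} = 0} := by
      refine MeasurableSet.imp ?_ ?_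
      · simp only [Set.ofPred_forall]
        exact MeasurableSet.iInter fun l =>
          (by fun_prop : Measurable fun q : Ω × (ℕ → X) => (q.1, q.2 l)) (hm i)
      · exact (hN.comp measurable_fst) (measurableSet_singleton 0)
    rw [← Measure.ae_ae_comm hset]
    refine Eventually.of_forall fun ω => ?_
    have hsec : MeasurableSet {x | (x, Z' i x ω) ∈ B i} :=
      (by fun_prop : Measurable fun x : X => (ω, x)) (hm i)
    by_cases h0 : μ {x | (x, Z' i x ω) ∉ B i} = 0
    · exact Eventually.of_forall fun _ _ => h0
    · have hlt : μ {x | (x, Z' i x ω) ∈ B i} < 1 := by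
        refine lt_of_le_of_ne prob_le_one fun h1 => h0 ?_
        exact (prob_compl_eq_zero_iff hsec).2 h1
      have hz := infinitePi_forall_mem_eq_zero μ hsec hlt
      filter_upwards [measure_eq_zero_iff_ae_notMem.1 hz] with ξ hξ hall
      exact absurd hall hξ
  obtain ⟨ξ, hξ⟩ := (ae_all_iff.2 key).exists
  refine ⟨ξ, ?_⟩
  filter_upwards [ae_all_iff.2 hξ, ae_all_iff.2 hZZ'] with ω h1 h2 i hl
  have := h1 i fun l => by rw [← h2 i]; exact hl l
  simp only [h2 i]
  exact this

/-- If the first of a sequence of i.i.d. jointly measurable processes satisfies each of the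
constraints `C i` over `K` with positive probability, then for every `i` there is an event of
positive probability, depending on the `i`-th process only, on which that process satisfies `C i`
at almost every point of `K`. -/
lemma IsIIDProcesses.exists_measurableSet_pos {X Ω S : Type*} [MeasurableSpace X]
    [MeasurableSpace Ω] [MeasurableSpace S] {P : Measure Ω} [IsProbabilityMeasure P]
    (μ : Measure X) [IsProbabilityMeasure μ] {Z : ℕ → X → Ω → S} (hiid : IsIIDProcesses P Z)
    (hZ : ∀ i, IsJointlyMeasurable P (Z i)) {K : Set X} (hK : MeasurableSet K)
    {C : ℕ → Set (X × S)} (hC : ∀ i, MeasurableSet (C i))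
    (hpos : ∀ i, 0 < P {ω | ∀ x ∈ K, (x, Z 0 x ω) ∈ C i}) :
    ∃ E : ℕ → Set (X → S), (∀ i, MeasurableSet (E i)) ∧
      (∀ i, 0 < P ((fun ω x => Z i x ω) ⁻¹' E i)) ∧
      ∀ᵐ ω ∂P, ∀ i, (fun x => Z i x ω) ∈ E i → ∀ᵐ x ∂μ, x ∈ K → (x, Z i x ω) ∈ C i := by
  have hB (i : ℕ) : MeasurableSet {q : X × S | q.1 ∈ K → q ∈ C i} :=
    MeasurableSet.imp (measurable_fst hK) (hC i)
  obtain ⟨ξ, hξ⟩ := exists_seq_forall_mem_imp_ae_mem P μ hZ hB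
  have hE (i : ℕ) : MeasurableSet {u : X → S | ∀ l, ξ l ∈ K → (ξ l, u (ξ l)) ∈ C i} := by
    have : {u : X → S | ∀ l, ξ l ∈ K → (ξ l, u (ξ l)) ∈ C i} =
        ⋂ l, (fun u : X → S => (ξ l, u (ξ l))) ⁻¹' {q : X × S | q.1 ∈ K → q ∈ C i} := by
      ext; simp
    rw [this]
    exact MeasurableSet.iInter fun l =>
      (by fun_prop : Measurable fun u : X → S => (ξ l, u (ξ l))) (hB i)
  refine ⟨fun i => {u | ∀ l, ξ l ∈ K → (ξ l, u (ξ l)) ∈ C i}, hE, fun i => ?_, hξ⟩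
  rw [(hiid.ident i).measure_mem_eq (hE i)]
  exact (hpos i).trans_le (measure_mono fun ω hω l hl => hω _ hl)

lemma isJointlyMeasurable_of_ae_continuous {X Ω : Type*} [TopologicalSpace X] [PolishSpace X]
    [MeasurableSpace X] [BorelSpace X] [MeasurableSpace Ω] {P : Measure Ω} {V : X → Ω → ℝ}
    (hV : ∀ x, Measurable (V x)) (hc : ∀ᵐ ω ∂P, Continuous fun x => V x ω) :
    IsJointlyMeasurable P V := by
  classical
  obtain ⟨N, hN, hNm, hN0⟩ := exists_measurable_superset_of_null hc
  refine ⟨fun x ω => if ω ∈ N then 0 else V x ω, ?_, ?_⟩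
  · refine measurable_uncurry_of_continuous_of_measurable
      (u := fun x ω => if ω ∈ N then 0 else V x ω) (fun ω => ?_) fun x => ?_
    · by_cases h : ω ∈ N
      · simpa [h] using continuous_const
      · simp only [h, if_false]
        by_contra hcon
        exact h (hN hcon)
    · exact Measurable.ite hNm measurable_const (hV x)
  · filter_upwards [measure_eq_zero_iff_ae_notMem.1 hN0] with ω hω x
    simp [hω]

/-! ### Stick-breaking -/

/-- The sticks `w i / (1 - ∑ j < i, w j)` break off the weights `w`. -/
lemma stickWeight_div_one_sub_sum {w : ℕ → ℝ} (hw : ∀ i, ∑ j ∈ Finset.range i, w j < 1) (i : ℕ) :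
    stickWeight (fun i => w i / (1 - ∑ j ∈ Finset.range i, w j)) i = w i := by
  have hprod : ∏ k ∈ Finset.range i, (1 - w k / (1 - ∑ j ∈ Finset.range k, w j)) =
      1 - ∑ j ∈ Finset.range i, w j := by
    induction i with
    | zero => simp
    | succ n ih =>
      have := sub_ne_zero.2 (hw n).ne'
      rw [Finset.prod_range_succ, ih, Finset.sum_range_succ]
      field_simp
      ring
  have := sub_ne_zero.2 (hw i).ne'
  rw [stickWeight, hprod]
  field_simp

/-- The weights depend continuously on the sticks. The factors `1 - v j` are at most `2` in absolute
value, whence the power of `2`. -/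
lemma abs_stickWeight_sub_le {v h : ℕ → ℝ} {δ : ℝ} (hδ1 : δ ≤ 1) {i : ℕ}
    (hh : ∀ j ≤ i, h j ∈ Set.Icc (0 : ℝ) 1) (hv : ∀ j ≤ i, |v j - h j| ≤ δ) :
    |stickWeight v i - stickWeight h i| ≤ 2 ^ (i + 1) * δ := by
  have hδ0 : 0 ≤ δ := (abs_nonneg _).trans (hv 0 i.zero_le)
  have hprod (n : ℕ) (hn : n ≤ i) :
      |∏ j ∈ Finset.range n, (1 - v j) - ∏ j ∈ Finset.range n, (1 - h j)| ≤ (2 ^ n - 1) * δ ∧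
      |∏ j ∈ Finset.range n, (1 - h j)| ≤ 1 := by
    induction n with
    | zero => simp
    | succ n ih =>
      obtain ⟨ih1, ih2⟩ := ih (by omega)
      have hvn := hv n (by omega)
      obtain ⟨h0, h1⟩ := hh n (by omega)
      have hv2 : |1 - v n| ≤ 2 := by
        rw [abs_le] at hvn ⊢; constructor <;> linarith
      have h1' : |1 - h n| ≤ 1 := by rw [abs_le]; constructor <;> linarith
      rw [Finset.prod_range_succ, Finset.prod_range_succ]
      set a := ∏ j ∈ Finset.range n, (1 - v j)
      set b := ∏ j ∈ Finset.range n, (1 - h j)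
      refine ⟨?_, ?_⟩
      · have : a * (1 - v n) - b * (1 - h n) = (a - b) * (1 - v n) - b * (v n - h n) := by ring
        rw [this]
        refine (abs_sub _ _).trans ?_
        rw [abs_mul, abs_mul]
        calc _ ≤ (2 ^ n - 1) * δ * 2 + 1 * δ := by
              refine add_le_add (mul_le_mul ih1 hv2 (abs_nonneg _) ((abs_nonneg _).trans ih1))
                (mul_le_mul ih2 hvn (abs_nonneg _) zero_le_one)
          _ = _ := by ring
      · rw [abs_mul]
        exact mul_le_one₀ ih2 (abs_nonneg _) h1'
  obtain ⟨hp1, hp2⟩ := hprod i le_rfl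
  have hvi := hv i le_rfl
  obtain ⟨h0, h1⟩ := hh i le_rfl
  have hv2 : |v i| ≤ 2 := by
    rw [abs_le] at hvi ⊢; constructor <;> linarith
  rw [stickWeight, stickWeight]
  set a := ∏ j ∈ Finset.range i, (1 - v j)
  set b := ∏ j ∈ Finset.range i, (1 - h j)
  have : v i * a - h i * b = v i * (a - b) + (v i - h i) * b := by ring
  rw [this]
  refine (abs_add_le _ _).trans ?_
  rw [abs_mul, abs_mul]
  calc _ ≤ 2 * ((2 ^ i - 1) * δ) + δ * 1 :=
        add_le_add (mul_le_mul hv2 hp1 (abs_nonneg _) zero_le_two)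
          (mul_le_mul hvi hp2 (abs_nonneg _) hδ0)
    _ ≤ 2 ^ (i + 1) * δ := by rw [pow_succ]; linarith

/-! ### Approximation of a mixing measure by a discrete one -/

/-- If the discrete measure `G` puts on an atom in (or near) each piece of a partition not much less
than the mass of that piece under `Q`, then the integral of a bounded nonnegative function that
varies little over the pieces is not much less under `G` than under `Q`. -/
lemma integral_le_integral_sum_dirac_add {Θ : Type*} [MeasurableSpace Θ] {Q G : Measure Θ}
    [IsProbabilityMeasure Q] [IsProbabilityMeasure G] {c : ℕ → ℝ} {t : ℕ → Θ}
    (hG : G = Measure.sum fun i => ENNReal.ofReal (c i) • Measure.dirac (t i))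
    {f : Θ → ℝ} (hf : Measurable f) {M : ℝ} (hf0 : ∀ s, 0 ≤ f s) (hfM : ∀ s, f s ≤ M)
    {A : ℕ → Set Θ} (hA : ∀ i, MeasurableSet (A i)) (hdisj : Pairwise (Function.onFun Disjoint A))
    {N : ℕ} (hcover : ⋃ i ∈ Finset.range N, A i = Set.univ) {ε e : ℝ} (he : 0 ≤ e)
    (hosc : ∀ i < N, Q (A i) = 0 ∨ ∀ s ∈ A i, |f s - f (t i)| ≤ ε)
    (hc : ∀ i < N, Q.real (A i) ≤ c i + e) :
    ∫ s, f s ∂Q ≤ ∫ s, f s ∂G + ε + N * e * M := by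
  have hfi (μ : Measure Θ) [IsFiniteMeasure μ] : Integrable f μ :=
    Integrable.of_bound hf.aestronglyMeasurable M (Eventually.of_forall fun s => by
      rw [Real.norm_eq_abs, abs_of_nonneg (hf0 s)]; exact hfM s)
  have hsplit : ∫ s, f s ∂Q = ∑ i ∈ Finset.range N, ∫ s in A i, f s ∂Q := by
    rw [← setIntegral_univ, ← hcover]
    exact integral_biUnion_finset _ (fun i _ => hA i) (fun i _ j _ hij => hdisj hij)
      fun i _ => (hfi Q).integrableOn
  have hone : ∑ i ∈ Finset.range N, Q.real (A i) = 1 := by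
    rw [← measureReal_biUnion_finset (fun i _ j _ hij => hdisj hij) fun i _ => hA i, hcover,
      probReal_univ]
  have hpiece (i : ℕ) (hi : i < N) :
      ∫ s in A i, f s ∂Q ≤ Q.real (A i) * (f (t i) + ε) := by
    rcases hosc i hi with h | h
    · rw [Measure.restrict_eq_zero.2 h, integral_zero_measure, measureReal_def, h]
      simp
    · calc ∫ s in A i, f s ∂Q ≤ ∫ _ in A i, (f (t i) + ε) ∂Q :=
            setIntegral_mono_on (hfi Q).integrableOn (integrable_const _) (hA i) fun s hs => by
              linarith [(abs_le.1 (h s hs)).2]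
        _ = _ := by rw [setIntegral_const, smul_eq_mul]
  have hGle : ∑ i ∈ Finset.range N, (ENNReal.ofReal (c i)).toReal * f (t i) ≤ ∫ s, f s ∂G := by
    have hsub : ∑ i ∈ Finset.range N, ENNReal.ofReal (c i) • Measure.dirac (t i) ≤ G := by
      rw [hG]
      refine Measure.le_iff.2 fun s hs => ?_
      rw [Measure.finsetSum_apply, Measure.sum_apply _ hs]
      exact ENNReal.sum_le_tsum _
    calc _ = ∫ s, f s ∂(∑ i ∈ Finset.range N, ENNReal.ofReal (c i) • Measure.dirac (t i)) := by
          rw [integral_finsetSum_measure fun i _ =>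
            (hfi (Measure.dirac (t i))).smul_measure ENNReal.ofReal_ne_top]
          refine Finset.sum_congr rfl fun i _ => ?_
          rw [integral_smul_measure, integral_dirac' _ _ hf.stronglyMeasurable, smul_eq_mul]
      _ ≤ ∫ s, f s ∂G := integral_mono_measure hsub (Eventually.of_forall hf0) (hfi G)
  have hterm (i : ℕ) (hi : i < N) : Q.real (A i) * (f (t i) + ε) ≤
      (ENNReal.ofReal (c i)).toReal * f (t i) + e * M + Q.real (A i) * ε := by
    have h1 : Q.real (A i) ≤ (ENNReal.ofReal (c i)).toReal + e := by
      rw [ENNReal.toReal_ofReal']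
      exact (hc i hi).trans (by linarith [le_max_left (c i) 0])
    have h2 := mul_le_mul_of_nonneg_right h1 (hf0 (t i))
    have h3 := mul_le_mul_of_nonneg_left (hfM (t i)) he
    linarith
  calc ∫ s, f s ∂Q
      ≤ ∑ i ∈ Finset.range N,
          ((ENNReal.ofReal (c i)).toReal * f (t i) + e * M + Q.real (A i) * ε) := by
        rw [hsplit]
        exact Finset.sum_le_sum fun i hi =>
          (hpiece i (Finset.mem_range.1 hi)).trans (hterm i (Finset.mem_range.1 hi))
    _ = ∑ i ∈ Finset.range N, (ENNReal.ofReal (c i)).toReal * f (t i) + N * e * M + ε := by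
        rw [Finset.sum_add_distrib, Finset.sum_add_distrib, ← Finset.sum_mul,
          ← Finset.sum_mul, hone]
        simp [mul_assoc]
    _ ≤ _ := by linarith

/-! ### Support of dependent Dirichlet processes -/

lemma IsIIDProcesses.measure_iInter_pos {X Ω S : Type*} [MeasurableSpace Ω] [MeasurableSpace S]
    {P : Measure Ω} {Z : ℕ → X → Ω → S} (hZ : IsIIDProcesses P Z) {E : ℕ → Set (X → S)}
    (hE : ∀ i, MeasurableSet (E i)) (hpos : ∀ i, 0 < P ((fun ω x => Z i x ω) ⁻¹' E i)) (N : ℕ) :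
    0 < P (⋂ i ∈ Finset.range N, (fun ω x => Z i x ω) ⁻¹' E i) := by
  rw [hZ.indep.measure_inter_preimage_eq_mul (Finset.range N) fun i _ => hE i]
  exact pos_iff_ne_zero.2 (Finset.prod_ne_zero_iff.2 fun i _ => (hpos i).ne')

lemma measure_inter_iInter_pos {X Ω S T : Type*} [MeasurableSpace Ω] [MeasurableSpace S]
    [MeasurableSpace T] {P : Measure Ω} {Z : ℕ → X → Ω → S} {W : ℕ → X → Ω → T}
    (hZ : IsIIDProcesses P Z) (hW : IsIIDProcesses P W)
    (hind : IndepFun (fun (ω : Ω) (i : ℕ) (x : X) => Z i x ω)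
      (fun (ω : Ω) (i : ℕ) (x : X) => W i x ω) P)
    {E : ℕ → Set (X → S)} (hE : ∀ i, MeasurableSet (E i)) {F : ℕ → Set (X → T)}
    (hF : ∀ i, MeasurableSet (F i)) (hposE : ∀ i, 0 < P ((fun ω x => Z i x ω) ⁻¹' E i))
    (hposF : ∀ i, 0 < P ((fun ω x => W i x ω) ⁻¹' F i)) (N : ℕ) :
    0 < P {ω | ∀ i < N, (fun x => Z i x ω) ∈ E i ∧ (fun x => W i x ω) ∈ F i} := by
  have h := hind.measure_inter_preimage_eq_mul
    (⋂ i ∈ Finset.range N, (fun u : ℕ → X → S => u i) ⁻¹' E i)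
    (⋂ i ∈ Finset.range N, (fun u : ℕ → X → T => u i) ⁻¹' F i)
    (Finset.measurableSet_biInter _ fun i _ => measurable_pi_apply i (hE i))
    (Finset.measurableSet_biInter _ fun i _ => measurable_pi_apply i (hF i))
  have h1 := hZ.measure_iInter_pos hE hposE N
  have h2 := hW.measure_iInter_pos hF hposF N
  simp only [Set.preimage_iInter] at h
  refine (ENNReal.mul_pos h1.ne' h2.ne').trans_le ((le_of_eq h.symm).trans (measure_mono ?_))
  intro ω hω i hi
  simp only [Set.mem_inter_iff, Set.mem_iInter, Finset.mem_range, Set.mem_preimage] at hω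
  exact ⟨hω.1 i hi, hω.2 i hi⟩

/-- A dependent Dirichlet process puts positive mass on uniform neighbourhoods over compact sets,
when only the mixtures of one bounded kernel are compared. The target weights of the pieces of a
fine partition of the parameter space are realised by sticks close to a continuous stick-breaking
of these weights, and the first atoms visit the pieces. -/
theorem IsDDP.measure_ae_abs_integral_sub_le_pos
    {X Y Θ Ω : Type*}
    [TopologicalSpace X] [PolishSpace X] [MeasurableSpace X] [BorelSpace X]
    [TopologicalSpace Y] [CompactSpace Y]
    [TopologicalSpace Θ] [PolishSpace Θ] [CompactSpace Θ] [MeasurableSpace Θ] [BorelSpace Θ]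
    [MeasurableSpace Ω] {P : Measure Ω} [IsProbabilityMeasure P]
    {V : ℕ → X → Ω → ℝ} {α : X → ℝ≥0} {θ : ℕ → X → Ω → Θ} {G0 : X → ProbabilityMeasure Θ}
    {G : X → Ω → ProbabilityMeasure Θ} (hG : IsDDP P V α θ G0 G)
    (hθ : ∀ i, IsJointlyMeasurable P (θ i))
    (hV_cont : ∀ i, ∀ᵐ ω ∂P, Continuous fun x => V i x ω)
    (hV_supp : ∀ ε : ℝ, 0 < ε → ∀ h : X → ℝ, Continuous h → (∀ x, h x ∈ Set.Icc (0 : ℝ) 1) →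
      ∀ K : Set X, IsCompact K → 0 < P {ω | ∀ x ∈ K, |V 0 x ω - h x| < ε})
    {P0 : X → ProbabilityMeasure Θ} (hP0 : StronglyContinuous P0)
    (hatoms : AtomsVisitOpenSets P θ ∨ (AtomsVisitPositiveSets P θ G0 ∧
      ∀ x, (P0 x : Measure Θ) ≪ (G0 x : Measure Θ)))
    {k : Y → Θ → ℝ} (hk : Continuous fun p : Y × Θ => k p.1 p.2) {M : ℝ} (hM : 0 ≤ M)
    (hk0 : ∀ y t, 0 ≤ k y t) (hkM : ∀ y t, k y t ≤ M)
    (μ : Measure X) [IsProbabilityMeasure μ] {K : Set X} (hK : IsCompact K) {ε : ℝ} (hε : 0 < ε) :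
    0 < P {ω | ∀ᵐ x ∂μ, x ∈ K → ∀ y,
      |∫ t, k y t ∂(G x ω : Measure Θ) - ∫ t, k y t ∂(P0 x : Measure Θ)| ≤ ε} := by
  obtain ⟨x₀⟩ : Nonempty X := μ.nonempty_of_neZero
  have hΘ : Nonempty Θ := (P0 x₀).nonempty
  -- a countable cover of the parameter space by sets of small oscillation
  let F : C(Θ, C(Y, ℝ)) := ContinuousMap.curry ⟨fun p : Θ × Y => k p.2 p.1, by fun_prop⟩
  have hFk (t : Θ) (y : Y) : F t y = k y t := rfl
  let τ : ℕ → Θ := TopologicalSpace.denseSeq Θ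
  let U : ℕ → Set Θ := fun i => F ⁻¹' Metric.ball (F (τ i)) (ε / 4)
  have hUo (i : ℕ) : IsOpen (U i) := Metric.isOpen_ball.preimage F.continuous
  have hUn (i : ℕ) : (U i).Nonempty := ⟨τ i, Metric.mem_ball_self (by positivity)⟩
  have hUosc (i : ℕ) (s t : Θ) (hs : s ∈ U i) (ht : t ∈ U i) (y : Y) :
      |k y s - k y t| ≤ ε / 2 := by
    have h1 := (ContinuousMap.dist_apply_le_dist y).trans_lt (Metric.mem_ball.1 hs)
    have h2 := (ContinuousMap.dist_apply_le_dist y).trans_lt (Metric.mem_ball.1 ht)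
    have h3 := dist_triangle_right (F s y) (F t y) (F (τ i) y)
    rw [hFk] at h1 h2
    rw [hFk, hFk, Real.dist_eq] at h3
    linarith
  have hUcover : Set.univ ⊆ ⋃ i, U i := by
    intro s _
    obtain ⟨i, hi⟩ := (TopologicalSpace.denseRange_denseSeq Θ).exists_mem_open
      (Metric.isOpen_ball.preimage F.continuous : IsOpen (F ⁻¹' Metric.ball (F s) (ε / 4)))
      ⟨s, Metric.mem_ball_self (by positivity)⟩
    exact Set.mem_iUnion.2 ⟨i, Metric.mem_ball_comm.1 hi⟩
  obtain ⟨N, hN⟩ : ∃ N, ⋃ i ∈ Finset.range N, U i = Set.univ := by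
    obtain ⟨s, hs⟩ := isCompact_univ.elim_finite_subcover U hUo hUcover
    obtain ⟨N, hN⟩ := s.exists_nat_subset_range
    exact ⟨N, Set.univ_subset_iff.1 (hs.trans (Set.biUnion_subset_biUnion_left hN))⟩
  let A : ℕ → Set Θ := disjointed U
  have hAU (i : ℕ) : A i ⊆ U i := disjointed_subset U i
  have hAm (i : ℕ) : MeasurableSet (A i) :=
    MeasurableSet.disjointed (fun i => (hUo i).measurableSet) i
  have hAd : Pairwise (Function.onFun Disjoint A) := disjoint_disjointed U
  have hAcover : ⋃ i ∈ Finset.range N, A i = Set.univ := by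
    rw [← hN]
    refine subset_antisymm (Set.iUnion₂_mono fun i _ => hAU i) fun s hs => ?_
    simp only [Set.mem_iUnion, Finset.mem_range, exists_prop] at hs ⊢
    classical
    have hex : ∃ i, s ∈ U i := ⟨_, hs.choose_spec.2⟩
    refine ⟨Nat.find hex, (Nat.find_min' hex hs.choose_spec.2).trans_lt hs.choose_spec.1, ?_⟩
    rw [show A = disjointed U from rfl, disjointed_eq_inter_compl]
    refine ⟨Nat.find_spec hex, ?_⟩
    simp only [Set.mem_iInter, Set.mem_compl_iff]
    exact fun j hj => Nat.find_min hex hj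
  -- the atoms visit a set attached to every piece that carries mass
  obtain ⟨C, hCm, hCpos, hCosc⟩ : ∃ C : ℕ → Set Θ, (∀ i, MeasurableSet (C i)) ∧
      (∀ i, 0 < P {ω | ∀ x ∈ K, θ 0 x ω ∈ C i}) ∧
      ∀ i, (∀ x, (P0 x : Measure Θ) (A i) = 0) ∨
        ∀ s ∈ A i, ∀ t ∈ C i, ∀ y, |k y s - k y t| ≤ ε / 2 := by
    rcases hatoms with h | ⟨⟨R, hR, h⟩, hac⟩
    · exact ⟨U, fun i => (hUo i).measurableSet, fun i => h _ (hUo i) (hUn i) K hK,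
        fun i => Or.inr fun s hs t ht => hUosc i s t (hAU i hs) ht⟩
    · classical
      -- a piece of `R`-measure zero has no target weight, so its atom may lie anywhere
      refine ⟨fun i => if R (A i) = 0 then Set.univ else A i, fun i => ?_, fun i => ?_,
        fun i => ?_⟩
      · by_cases hRi : R (A i) = 0 <;> simp [hRi, hAm i]
      · by_cases hRi : R (A i) = 0
        · simp [hRi]
        · simp only [hRi, if_false]
          exact h _ (hAm i) (pos_iff_ne_zero.2 hRi) K hK
      · by_cases hRi : R (A i) = 0
        · exact Or.inl fun x => hac x (hR x hRi)
        · simp only [hRi, if_false]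
          exact Or.inr fun s hs t ht => hUosc i s t (hAU i hs) (hAU i ht)
  -- sticks breaking off the target weights, scaled down a little so that the stick never vanishes
  set η : ℝ := min (1 / 2) (ε / (4 * (M + 1) * (N + 1))) with hη
  have hη0 : 0 < η := by positivity
  have hη1 : η ≤ 1 / 2 := min_le_left _ _
  have hηM : N * (η + η) * M ≤ ε / 2 := by
    have h1 : η * (4 * (M + 1) * (N + 1)) ≤ ε :=
      (le_div_iff₀ (by positivity)).1 (min_le_right _ _)
    have h2 : N * M * η ≤ (M + 1) * (N + 1) * η := by
      refine mul_le_mul_of_nonneg_right ?_ hη0.le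
      have : (0 : ℝ) ≤ N := by positivity
      nlinarith
    linarith
  let p : ℕ → X → ℝ := fun i x => (P0 x : Measure Θ).real (A i)
  have hp0 (i : ℕ) (x : X) : 0 ≤ p i x := measureReal_nonneg
  have hpc (i : ℕ) : Continuous (p i) := by
    have := hP0 ((A i).indicator fun _ => 1) (measurable_const.indicator (hAm i))
      ⟨1, fun t => by by_cases h : t ∈ A i <;> simp [h]⟩
    refine this.congr fun x => ?_
    rw [integral_indicator_const _ (hAm i), smul_eq_mul, mul_one]
  have hpsum (n : ℕ) (x : X) : ∑ i ∈ Finset.range n, p i x ≤ 1 := by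
    rw [← measureReal_biUnion_finset (fun i _ j _ hij => hAd hij) fun i _ => hAm i]
    exact measureReal_le_one
  let w : ℕ → X → ℝ := fun i x => (1 - η) * p i x
  have hwsum (n : ℕ) (x : X) : ∑ i ∈ Finset.range n, w i x ≤ 1 - η := by
    rw [← Finset.mul_sum]
    exact mul_le_of_le_one_right (by linarith) (hpsum n x)
  have hwlt (x : X) (n : ℕ) : ∑ i ∈ Finset.range n, w i x < 1 := by linarith [hwsum n x]
  have hw0 (i : ℕ) (x : X) : 0 ≤ w i x := mul_nonneg (by linarith) (hp0 i x)
  let h : ℕ → X → ℝ := fun i x => w i x / (1 - ∑ j ∈ Finset.range i, w j x)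
  have hh (i : ℕ) (x : X) : h i x ∈ Set.Icc (0 : ℝ) 1 := by
    have h1 := hwlt x i
    refine ⟨div_nonneg (hw0 i x) (by linarith), (div_le_one (by linarith)).2 ?_⟩
    have h2 := hwlt x (i + 1)
    rw [Finset.sum_range_succ] at h2
    linarith
  have hwc (i : ℕ) : Continuous (w i) := (hpc i).const_mul _
  have hhc (i : ℕ) : Continuous (h i) :=
    (hwc i).div (continuous_const.sub (continuous_finsetSum _ fun j _ => hwc j))
      fun x => by linarith [hwlt x i]
  set δ : ℝ := η / 2 ^ N with hδ
  have hδ0 : 0 < δ := by positivity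
  have hδ1 : δ ≤ 1 := by
    refine (div_le_self hη0.le (one_le_pow₀ one_le_two)).trans (by linarith)
  -- independent events of positive probability controlling the first sticks and atoms
  obtain ⟨E, hEm, hEpos, hE⟩ := hG.sticks.iid.exists_measurableSet_pos μ
    (fun i => isJointlyMeasurable_of_ae_continuous (hG.sticks.iid.measurable i) (hV_cont i))
    hK.measurableSet (C := fun i => {q : X × ℝ | |q.2 - h i q.1| < δ})
    (fun i => measurableSet_lt
      ((continuous_snd.sub ((hhc i).comp continuous_fst)).abs.measurable) measurable_const)
    (fun i => hV_supp δ hδ0 (h i) (hhc i) (hh i) K hK)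
  obtain ⟨D, hDm, hDpos, hD⟩ := hG.atoms_iid.exists_measurableSet_pos μ hθ
    hK.measurableSet (C := fun i => {q : X × Θ | q.2 ∈ C i}) (fun i => measurable_snd (hCm i))
    hCpos
  refine (measure_inter_iInter_pos hG.sticks.iid hG.atoms_iid hG.indep hEm hDm hEpos hDpos
    N).trans_le (measure_mono_ae ?_)
  filter_upwards [hE, hD, hG.representation] with ω hEω hDω hrep hω
  have hall : ∀ᵐ x ∂μ, ∀ i < N, x ∈ K → |V i x ω - h i x| < δ ∧ θ i x ω ∈ C i := by
    rw [ae_all_iff]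
    intro i
    by_cases hi : i < N
    · filter_upwards [hEω i (hω i hi).1, hDω i (hω i hi).2] with x h1 h2 _ hx
      exact ⟨h1 hx, h2 hx⟩
    · exact Eventually.of_forall fun x hi' => absurd hi' hi
  change ∀ᵐ x ∂μ, _
  filter_upwards [hall] with x hx hxK y
  have hc : ∀ i < N, p i x ≤ stickWeight (fun j => V j x ω) i + (η + η) := by
    intro i hi
    have h1 := abs_stickWeight_sub_le (v := fun j => V j x ω) (h := fun j => h j x) hδ1
      (i := i) (fun j _ => hh j x) fun j hj => (hx j (by omega) hxK).1.le
    have h2 : stickWeight (fun j => h j x) i = w i x :=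
      stickWeight_div_one_sub_sum (w := fun j => w j x) (hwlt x) i
    have h3 : (2 : ℝ) ^ (i + 1) * δ ≤ η := by
      calc (2 : ℝ) ^ (i + 1) * δ ≤ 2 ^ N * δ := by
            gcongr
            · exact one_le_two
            · omega
        _ = η := by rw [hδ]; field_simp
    rw [h2] at h1
    have h4 := (abs_le.1 h1).1
    have h5 : p i x ≤ 1 := measureReal_le_one
    have h6 : w i x = p i x - η * p i x := by simp only [w]; ring
    nlinarith
  have hosc (i : ℕ) (hi : i < N) : (P0 x : Measure Θ) (A i) = 0 ∨
      ∀ s ∈ A i, |k y s - k y (θ i x ω)| ≤ ε / 2 :=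
    (hCosc i).imp (fun h0 => h0 x) fun h0 s hs => h0 s hs _ (hx i hi hxK).2 y
  have hkm : Measurable (k y) := by
    have : Continuous (k y) := by fun_prop
    exact this.measurable
  have hki (Q : Measure Θ) [IsProbabilityMeasure Q] : Integrable (k y) Q :=
    Integrable.of_bound hkm.aestronglyMeasurable M (Eventually.of_forall fun s => by
      rw [Real.norm_eq_abs, abs_of_nonneg (hk0 y s)]; exact hkM y s)
  have hlow := integral_le_integral_sum_dirac_add (hrep x) hkm (hk0 y) (hkM y) hAm hAd hAcover
    (by positivity) hosc hc
  -- the upper bound is the lower bound for `M - k y`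
  have hup := integral_le_integral_sum_dirac_add (f := fun t => M - k y t) (M := M) (hrep x)
    (measurable_const.sub hkm) (fun s => sub_nonneg.2 (hkM y s))
    (fun s => by linarith [hk0 y s]) hAm hAd hAcover (by positivity) (ε := ε / 2)
    (fun i hi => (hosc i hi).imp id fun h0 s hs => by
      rw [sub_sub_sub_cancel_left, abs_sub_comm]; exact h0 s hs) hc
  rw [integral_sub (integrable_const _) (hki _), integral_sub (integrable_const _) (hki _),
    integral_const, integral_const, probReal_univ, probReal_univ] at hup
  rw [abs_le]
  constructor <;> linarith

/-- A single-atoms dependent Dirichlet process is a dependent Dirichlet process whose atom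
processes are constant in the predictor. -/
lemma IsThetaDDP.isDDP {X Θ Ω : Type*} [TopologicalSpace X] [MeasurableSpace Θ]
    [MeasurableSpace Ω] {P : Measure Ω} {V : ℕ → X → Ω → ℝ} {α : X → ℝ≥0} {θ : ℕ → Ω → Θ}
    {G0 : ProbabilityMeasure Θ} {G : X → Ω → ProbabilityMeasure Θ}
    (hG : IsThetaDDP P V α θ G0 G) :
    IsDDP P V α (fun i _ ω => θ i ω) (fun _ => G0) G := by
  have hconst : Measurable fun (t : Θ) (_ : X) => t := measurable_pi_lambda _ fun _ => measurable_id
  refine ⟨hG.measurable, hG.sticks, ⟨fun i _ => hG.atoms_measurable i, ?_, fun i => ?_⟩,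
    fun i _ => hG.atoms_law i, ?_, hG.representation⟩
  · exact hG.atoms_indep.comp (fun _ t _ => t) fun _ => hconst
  · have hid : IdentDistrib (θ i) (θ 0) P P :=
      ⟨(hG.atoms_measurable i).aemeasurable, (hG.atoms_measurable 0).aemeasurable, by
        rw [hG.atoms_law i, hG.atoms_law 0]⟩
    exact hid.comp hconst
  · exact hG.indep.comp (φ := id) (ψ := fun (t : ℕ → Θ) (i : ℕ) (_ : X) => t i) measurable_id
      (measurable_pi_lambda _ fun i => hconst.comp (measurable_pi_apply i))

/-- The random measures of a dependent Dirichlet process agree, outside a null set of outcomes,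
with a kernel from outcomes and predictors to the parameter space. -/
lemma IsDDP.exists_measurable_version {X Θ Ω : Type*} [TopologicalSpace X] [PolishSpace X]
    [MeasurableSpace X] [BorelSpace X] [MeasurableSpace Θ] [Nonempty Θ]
    [MeasurableSpace Ω] {P : Measure Ω}
    {V : ℕ → X → Ω → ℝ} {α : X → ℝ≥0} {θ : ℕ → X → Ω → Θ} {G0 : X → ProbabilityMeasure Θ}
    {G : X → Ω → ProbabilityMeasure Θ} (hG : IsDDP P V α θ G0 G)
    (hθ : ∀ i, IsJointlyMeasurable P (θ i))
    (hV_cont : ∀ i, ∀ᵐ ω ∂P, Continuous fun x => V i x ω) :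
    ∃ G' : X → Ω → ProbabilityMeasure Θ,
      Measurable (fun q : Ω × X => (G' q.2 q.1 : Measure Θ)) ∧ ∀ᵐ ω ∂P, ∀ x, G' x ω = G x ω := by
  classical
  have hV (i : ℕ) : IsJointlyMeasurable P (V i) :=
    isJointlyMeasurable_of_ae_continuous (hG.sticks.iid.measurable i) (hV_cont i)
  choose V' hV'm hV' using hV
  choose θ' hθ'm hθ' using hθ
  have hgood : ∀ᵐ ω ∂P, ∀ x, (G x ω : Measure Θ) = Measure.sum fun i =>
      ENNReal.ofReal (stickWeight (fun j => V' j x ω) i) • Measure.dirac (θ' i x ω) := by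
    filter_upwards [hG.representation, ae_all_iff.2 hV', ae_all_iff.2 hθ'] with ω h1 h2 h3 x
    rw [h1 x]
    simp only [h2 _ x, h3 _ x]
  obtain ⟨N, hN, hNm, hN0⟩ := exists_measurable_superset_of_null hgood
  have hNG (ω : Ω) (hω : ω ∉ N) (x : X) : (G x ω : Measure Θ) = Measure.sum fun i =>
      ENNReal.ofReal (stickWeight (fun j => V' j x ω) i) • Measure.dirac (θ' i x ω) := by
    by_contra hcon
    exact hω (hN fun hall => hcon (hall x))
  let δ₀ : ProbabilityMeasure Θ := ⟨Measure.dirac (Classical.arbitrary Θ), inferInstance⟩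
  let G' : X → Ω → ProbabilityMeasure Θ := fun x ω =>
    if ω ∈ N then δ₀ else G x ω
  refine ⟨G', ?_, ?_⟩
  · refine Measure.measurable_of_measurable_coe _ fun s hs => ?_
    have heq : (fun q : Ω × X => (G' q.2 q.1 : Measure Θ) s) = fun q : Ω × X =>
        if q.1 ∈ N then (δ₀ : Measure Θ) s else
          ∑' i, ENNReal.ofReal (stickWeight (fun j => V' j q.2 q.1) i) *
            s.indicator 1 (θ' i q.2 q.1) := by
      ext q
      by_cases hq : q.1 ∈ N
      · simp [G', hq]
      · simp only [G', hq, if_false]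
        rw [hNG q.1 hq q.2, Measure.sum_apply _ hs]
        simp only [Measure.smul_apply, Measure.dirac_apply' _ hs, smul_eq_mul]
    rw [heq]
    refine Measurable.ite (measurable_fst hNm) measurable_const (Measurable.tsum fun i => ?_)
    have hw : Measurable fun q : Ω × X => stickWeight (fun j => V' j q.2 q.1) i := by
      unfold stickWeight
      have hVm (j : ℕ) : Measurable fun q : Ω × X => V' j q.2 q.1 := (hV'm j).comp measurable_swap
      fun_prop
    exact hw.ennreal_ofReal.mul ((measurable_one.indicator hs).comp ((hθ'm i).comp measurable_swap))
  · filter_upwards [measure_eq_zero_iff_ae_notMem.1 hN0] with ω hω x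
    simp [G', hω]

/-! ### The kernel -/

lemma exists_bounds_of_continuous_pos {T : Type*} [TopologicalSpace T] [CompactSpace T]
    {f : T → ℝ≥0} (hf : Continuous f) (hpos : ∀ t, 0 < f t) :
    ∃ c M : ℝ≥0, 0 < c ∧ 0 < M ∧ ∀ t, c ≤ f t ∧ f t ≤ M := by
  rcases isEmpty_or_nonempty T with h | h
  · exact ⟨1, 1, one_pos, one_pos, fun t => h.elim t⟩
  · obtain ⟨t₁, _, h1⟩ := isCompact_univ.exists_isMinOn Set.univ_nonempty hf.continuousOn
    obtain ⟨t₂, _, h2⟩ := isCompact_univ.exists_isMaxOn Set.univ_nonempty hf.continuousOn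
    exact ⟨f t₁, f t₂, hpos _, hpos _, fun t => ⟨h1 (Set.mem_univ t), h2 (Set.mem_univ t)⟩⟩

lemma isFiniteMeasure_of_lintegral_kernel_eq_one {Y Θ : Type*} [TopologicalSpace Y]
    [CompactSpace Y] [MeasurableSpace Y] [TopologicalSpace Θ] {νY : Measure Y}
    {ψ : Y → Θ → ℝ≥0} (hψ_cont : Continuous fun p : Y × Θ => ψ p.1 p.2)
    (hψ_pos : ∀ y t, 0 < ψ y t) {t : Θ} (hψ_density : ∫⁻ y, ψ y t ∂νY = 1) :
    IsFiniteMeasure νY := by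
  obtain ⟨c, M, hc, -, h⟩ := exists_bounds_of_continuous_pos
    (f := fun y => ψ y t) (by fun_prop) fun y => hψ_pos y t
  have h1 : (c : ℝ≥0∞) * νY Set.univ ≤ 1 := by
    rw [← hψ_density, ← lintegral_const]
    exact lintegral_mono fun y => ENNReal.coe_le_coe.2 (h y).1
  refine ⟨lt_of_le_of_ne le_top fun htop => ?_⟩
  rw [htop, ENNReal.mul_top (by exact_mod_cast hc.ne')] at h1
  exact absurd h1 (by simp)

/-- A kernel of probability densities on a compact space that decays at infinity in the parameter
has a compact parameter space: outside a large compact set its total mass would be less than one. -/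
lemma DecaysInParameter.compactSpace {Y Θ : Type*} [TopologicalSpace Y] [CompactSpace Y]
    [MeasurableSpace Y] [TopologicalSpace Θ] {νY : Measure Y} [IsFiniteMeasure νY]
    {ψ : Y → Θ → ℝ≥0} (hψ_decay : DecaysInParameter ψ)
    (hψ_density : ∀ t, ∫⁻ y, ψ y t ∂νY = 1) : CompactSpace Θ := by
  obtain ⟨e, he, heν⟩ : ∃ e : ℝ≥0, 0 < e ∧ (e : ℝ≥0∞) * νY Set.univ < 1 := by
    refine ⟨((νY Set.univ).toNNReal + 1)⁻¹, by positivity, ?_⟩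
    rw [← ENNReal.coe_toNNReal (measure_ne_top νY Set.univ), ENNReal.toNNReal_coe]
    norm_cast
    rw [inv_mul_lt_iff₀ (by positivity), mul_one]
    exact lt_add_one _
  choose U hUo hU K hK hψK using fun y => hψ_decay y e he
  obtain ⟨s, hs⟩ := isCompact_univ.elim_finite_subcover U hUo
    fun y _ => Set.mem_iUnion.2 ⟨y, hU y⟩
  have huniv : (Set.univ : Set Θ) = ⋃ y ∈ s, K y := by
    refine (Set.eq_univ_of_forall fun t => ?_).symm
    by_contra ht
    simp only [Set.mem_iUnion, not_exists] at ht
    refine absurd heν (not_lt.2 ?_)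
    rw [← hψ_density t, ← lintegral_const]
    refine lintegral_mono fun y => ?_
    obtain ⟨y', hy', hy⟩ := Set.mem_iUnion₂.1 (hs (Set.mem_univ y))
    exact ENNReal.coe_le_coe.2 (hψK y' y hy t (ht y' hy')).le
  exact ⟨huniv ▸ s.isCompact_biUnion fun y _ => hK y⟩

lemma StronglyContinuous.measurable {X Θ : Type*} [TopologicalSpace X] [MeasurableSpace X]
    [OpensMeasurableSpace X] [MeasurableSpace Θ] {Q : X → ProbabilityMeasure Θ}
    (hQ : StronglyContinuous Q) : Measurable fun x => (Q x : Measure Θ) := by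
  classical
  refine Measure.measurable_of_measurable_coe _ fun s hs => ?_
  have h := hQ (s.indicator fun _ => 1) (measurable_const.indicator hs)
    ⟨1, fun t => by by_cases h : t ∈ s <;> simp [h]⟩
  convert h.measurable.ennreal_ofReal using 2 with x
  rw [integral_indicator_const _ hs, smul_eq_mul, mul_one, ofReal_measureReal]

lemma measurable_lintegral_kernel {T Y Θ : Type*} [MeasurableSpace T] [MeasurableSpace Y]
    [MeasurableSpace Θ] {ψ : Y → Θ → ℝ≥0} (hψ : Measurable fun p : Y × Θ => ψ p.1 p.2)
    {Q : T → ProbabilityMeasure Θ} (hQ : Measurable fun x => (Q x : Measure Θ)) :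
    Measurable fun z : Y × T => ∫⁻ t, ψ z.1 t ∂(Q z.2 : Measure Θ) := by
  let κ : Kernel (Y × T) Θ := ⟨fun z => (Q z.2 : Measure Θ), hQ.comp measurable_snd⟩
  have : IsMarkovKernel κ := ⟨fun z => inferInstanceAs (IsProbabilityMeasure (Q z.2 : Measure Θ))⟩
  exact Measurable.lintegral_kernel_prod_right (κ := κ)
    (f := fun z t => (ψ z.1 t : ℝ≥0∞)) (by
      have : Measurable fun p : (Y × T) × Θ => ψ p.1.1 p.2 :=
        hψ.comp (by fun_prop : Measurable fun p : (Y × T) × Θ => (p.1.1, p.2))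
      exact this.coe_nnreal_ennreal)

lemma measurable_integral_kernel {T Y Θ : Type*} [MeasurableSpace T] [MeasurableSpace Y]
    [MeasurableSpace Θ] {ψ : Y → Θ → ℝ≥0} (hψ : Measurable fun p : Y × Θ => ψ p.1 p.2)
    {Q : T → ProbabilityMeasure Θ} (hQ : Measurable fun x => (Q x : Measure Θ)) :
    Measurable fun z : Y × T => ∫ t, (ψ z.1 t : ℝ) ∂(Q z.2 : Measure Θ) := by
  convert (measurable_lintegral_kernel hψ hQ).ennreal_toReal using 2 with z
  have hz : Measurable (ψ z.1) := hψ.comp (by fun_prop : Measurable fun t : Θ => (z.1, t))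
  rw [integral_eq_lintegral_of_nonneg_ae (Eventually.of_forall fun t => (ψ z.1 t).coe_nonneg)
    hz.coe_nnreal_real.aestronglyMeasurable]
  simp

lemma measurable_jointDensity {X Y Θ : Type*} [MeasurableSpace X] [MeasurableSpace Y]
    [MeasurableSpace Θ] {p0 : X → ℝ≥0} (hp0 : Measurable p0) {ψ : Y → Θ → ℝ≥0}
    (hψ : Measurable fun p : Y × Θ => ψ p.1 p.2)
    {Q : X → ProbabilityMeasure Θ} (hQ : Measurable fun x => (Q x : Measure Θ)) :
    Measurable (jointDensity p0 ψ Q) :=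
  (hp0.comp measurable_snd).coe_nnreal_ennreal.mul (measurable_lintegral_kernel hψ hQ)

/-- Whatever the mixing measures, the predictors have density `p0`. -/
lemma map_snd_withDensity_jointDensity {X Y Θ : Type*} [MeasurableSpace X] [MeasurableSpace Y]
    [MeasurableSpace Θ] {νY : Measure Y} [SFinite νY] {νX : Measure X} [SFinite νX]
    {p0 : X → ℝ≥0} (hp0 : Measurable p0) {ψ : Y → Θ → ℝ≥0}
    (hψ : Measurable fun p : Y × Θ => ψ p.1 p.2) (hψ_density : ∀ t, ∫⁻ y, ψ y t ∂νY = 1)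
    {Q : X → ProbabilityMeasure Θ} (hQ : Measurable fun x => (Q x : Measure Θ)) :
    Measure.map Prod.snd ((νY.prod νX).withDensity (jointDensity p0 ψ Q)) =
      νX.withDensity fun x => p0 x := by
  ext s hs
  have hint (x : X) : ∫⁻ y, jointDensity p0 ψ Q (y, x) ∂νY = p0 x := by
    have hy : Measurable fun y => ∫⁻ t, ψ y t ∂(Q x : Measure Θ) :=
      (measurable_lintegral_kernel hψ hQ).comp (by fun_prop : Measurable fun y : Y => (y, x))
    simp only [jointDensity]
    rw [lintegral_const_mul _ hy, lintegral_lintegral_swap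
      (hψ.coe_nnreal_ennreal.aemeasurable)]
    simp [hψ_density]
  rw [Measure.map_apply measurable_snd hs, withDensity_apply _ (measurable_snd hs),
    withDensity_apply _ hs, ← lintegral_indicator (measurable_snd hs),
    lintegral_prod_symm _ ((measurable_jointDensity hp0 hψ hQ).indicator
      (measurable_snd hs)).aemeasurable, ← lintegral_indicator hs]
  refine lintegral_congr fun x => ?_
  by_cases hx : x ∈ s
  · rw [Set.indicator_of_mem hx, ← hint x]
    refine lintegral_congr fun y => ?_
    exact Set.indicator_of_mem (s := Prod.snd ⁻¹' s) (a := (y, x)) hx _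
  · rw [Set.indicator_of_notMem hx]
    refine (lintegral_congr fun y => ?_).trans lintegral_zero
    exact Set.indicator_of_notMem (s := Prod.snd ⁻¹' s) (a := (y, x)) hx _

lemma lintegral_jointDensity {X Y Θ : Type*} [MeasurableSpace X] [MeasurableSpace Y]
    [MeasurableSpace Θ] {νY : Measure Y} [SFinite νY] {νX : Measure X} [SFinite νX]
    {p0 : X → ℝ≥0} (hp0 : Measurable p0) (hp0_density : ∫⁻ x, p0 x ∂νX = 1) {ψ : Y → Θ → ℝ≥0}
    (hψ : Measurable fun p : Y × Θ => ψ p.1 p.2) (hψ_density : ∀ t, ∫⁻ y, ψ y t ∂νY = 1)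
    {Q : X → ProbabilityMeasure Θ} (hQ : Measurable fun x => (Q x : Measure Θ)) :
    ∫⁻ z, jointDensity p0 ψ Q z ∂(νY.prod νX) = 1 := by
  have h := congrArg (fun m => m Set.univ)
    (map_snd_withDensity_jointDensity (νY := νY) (νX := νX) hp0 hψ hψ_density hQ)
  simpa [Measure.map_apply measurable_snd MeasurableSet.univ, hp0_density] using h

lemma lintegral_eq_ofReal_and_integral_bounds {Θ : Type*} [MeasurableSpace Θ] (Q : Measure Θ)
    [IsProbabilityMeasure Q] {f : Θ → ℝ≥0} (hf : Measurable f) {c M : ℝ≥0}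
    (h : ∀ t, c ≤ f t ∧ f t ≤ M) :
    ∫⁻ t, f t ∂Q = ENNReal.ofReal (∫ t, (f t : ℝ) ∂Q) ∧
      (c : ℝ) ≤ ∫ t, (f t : ℝ) ∂Q ∧ ∫ t, (f t : ℝ) ∂Q ≤ M := by
  have hi : Integrable (fun t => (f t : ℝ)) Q :=
    Integrable.of_bound hf.coe_nnreal_real.aestronglyMeasurable M
      (Eventually.of_forall fun t => by simpa using (h t).2)
  refine ⟨?_, ?_, ?_⟩
  · rw [ofReal_integral_eq_lintegral_ofReal hi (Eventually.of_forall fun t => (f t).coe_nonneg)]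
    simp
  · simpa using integral_mono (integrable_const (c : ℝ)) hi fun t => NNReal.coe_le_coe.2 (h t).1
  · simpa using integral_mono hi (integrable_const (M : ℝ)) fun t => NNReal.coe_le_coe.2 (h t).2

/-! ### Posterior consistency -/

/-- Weak consistency for dependent Dirichlet processes, when the kernel is bounded away from `0`
and `∞`. The likelihood ratios are then bounded, so uniform approximation of the true mixtures
over a compact set carrying most of the predictors gives Kullback–Leibler support. -/
theorem IsDDP.weaklyConsistentAt
    {X Y Θ Ω : Type*}
    [TopologicalSpace X] [PolishSpace X] [MeasurableSpace X] [BorelSpace X]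
    [TopologicalSpace Y] [PolishSpace Y] [MeasurableSpace Y] [BorelSpace Y] [CompactSpace Y]
    [TopologicalSpace Θ] [PolishSpace Θ] [CompactSpace Θ] [MeasurableSpace Θ] [BorelSpace Θ]
    [Nonempty Θ] [MeasurableSpace Ω] {P : Measure Ω} [IsProbabilityMeasure P]
    {νY : Measure Y} [SFinite νY] {ψ : Y → Θ → ℝ≥0}
    (hψ_cont : Continuous fun p : Y × Θ => ψ p.1 p.2)
    (hψ_pos : ∀ y t, 0 < ψ y t) (hψ_density : ∀ t, ∫⁻ y, ψ y t ∂νY = 1)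
    {νX : Measure X} [SFinite νX] {p0 : X → ℝ≥0} (hp0 : Measurable p0)
    (hp0_density : ∫⁻ x, p0 x ∂νX = 1)
    {P0 : X → ProbabilityMeasure Θ} (hP0 : StronglyContinuous P0)
    {V : ℕ → X → Ω → ℝ} {α : X → ℝ≥0} {θ : ℕ → X → Ω → Θ} {G0 : X → ProbabilityMeasure Θ}
    {G : X → Ω → ProbabilityMeasure Θ} (hG : IsDDP P V α θ G0 G)
    (hθ : ∀ i, IsJointlyMeasurable P (θ i))
    (hV_cont : ∀ i, ∀ᵐ ω ∂P, Continuous fun x => V i x ω)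
    (hV_supp : ∀ ε : ℝ, 0 < ε → ∀ h : X → ℝ, Continuous h → (∀ x, h x ∈ Set.Icc (0 : ℝ) 1) →
      ∀ K : Set X, IsCompact K → 0 < P {ω | ∀ x ∈ K, |V 0 x ω - h x| < ε})
    (hatoms : AtomsVisitOpenSets P θ ∨ (AtomsVisitPositiveSets P θ G0 ∧
      ∀ x, (P0 x : Measure Θ) ≪ (G0 x : Measure Θ))) :
    WeaklyConsistentAt (νY.prod νX) P (fun ω => jointDensity p0 ψ fun x => G x ω)
      (jointDensity p0 ψ P0) := by
  obtain ⟨c, M, hc, hM, hcM⟩ := exists_bounds_of_continuous_pos hψ_cont fun p => hψ_pos p.1 p.2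
  have hψm : Measurable fun p : Y × Θ => ψ p.1 p.2 := hψ_cont.measurable
  have hψy (y : Y) : Measurable (ψ y) := hψm.comp (by fun_prop : Measurable fun t : Θ => (y, t))
  obtain ⟨G', hG'm, hG'⟩ := hG.exists_measurable_version hθ hV_cont
  have hP0m := hP0.measurable
  have hG'ω (ω : Ω) : Measurable fun x => (G' x ω : Measure Θ) :=
    hG'm.comp (by fun_prop : Measurable fun x : X => (ω, x))
  -- the conditional densities, as real numbers
  let I : ProbabilityMeasure Θ → Y → ℝ := fun Q y => ∫ t, (ψ y t : ℝ) ∂(Q : Measure Θ)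
  have hI (Q : ProbabilityMeasure Θ) (y : Y) :=
    lintegral_eq_ofReal_and_integral_bounds (Q : Measure Θ) (hψy y)
      fun t => hcM (y, t)
  have hIpos (Q : ProbabilityMeasure Θ) (y : Y) : 0 < I Q y :=
    (NNReal.coe_pos.2 hc).trans_le (hI Q y).2.1
  have hjoint (Q : X → ProbabilityMeasure Θ) (z : Y × X) :
      jointDensity p0 ψ Q z = p0 z.2 * ENNReal.ofReal (I (Q z.2) z.1) := by
    rw [jointDensity, (hI (Q z.2) z.1).1]
  let ρ : Ω → Y × X → ℝ := fun ω z => I (G' z.2 ω) z.1 / I (P0 z.2) z.1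
  have hρm : Measurable fun q : Ω × (Y × X) => ρ q.1 q.2 := by
    refine Measurable.div ?_ ?_
    · exact (measurable_integral_kernel (Q := fun r : Ω × X => G' r.2 r.1) hψm hG'm).comp
        (by fun_prop : Measurable fun q : Ω × (Y × X) => (q.2.1, (q.1, q.2.2)))
    · exact (measurable_integral_kernel hψm hP0m).comp measurable_snd
  have hρω (ω : Ω) : Measurable (ρ ω) := hρm.comp (by fun_prop : Measurable fun z : Y × X => (ω, z))
  have hcR : (0 : ℝ) < c := NNReal.coe_pos.2 hc
  have hMR : (0 : ℝ) < M := NNReal.coe_pos.2 hM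
  have hρa (ω : Ω) (z : Y × X) : (c : ℝ) / M ≤ ρ ω z :=
    div_le_div₀ (hIpos _ _).le (hI _ _).2.1 (hIpos _ _) (hI _ _).2.2
  have hρb (ω : Ω) (z : Y × X) : ρ ω z ≤ (M : ℝ) / c :=
    div_le_div₀ hMR.le (hI _ _).2.2 hcR (hI _ _).2.1
  have hρpos (ω : Ω) (z : Y × X) : 0 < ρ ω z := div_pos (hIpos _ _) (hIpos _ _)
  have hmul (ω : Ω) (z : Y × X) : jointDensity p0 ψ (fun x => G' x ω) z =
      jointDensity p0 ψ P0 z * ENNReal.ofReal (ρ ω z) := by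
    rw [hjoint, hjoint, mul_assoc, ← ENNReal.ofReal_mul (hIpos _ _).le,
      mul_div_cancel₀ _ (hIpos _ _).ne']
  have hm0 := measurable_jointDensity hp0 hψm hP0m
  have hm0_one := lintegral_jointDensity (νY := νY) hp0 hp0_density hψm hψ_density hP0m
  set Q0 : Measure (Y × X) := (νY.prod νX).withDensity (jointDensity p0 ψ P0) with hQ0
  have hQ0prob : IsProbabilityMeasure Q0 := ⟨by
    rw [hQ0, withDensity_apply _ MeasurableSet.univ, setLIntegral_univ, hm0_one]⟩
  refine weaklyConsistentAt_of_likelihoodRatio (νY.prod νX) P hm0 (fun z => ?_) hm0_one hρm ?_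
    (div_pos hcR hMR) hρa hρb (fun ω => ?_) fun ε hε => ?_
  · rw [hjoint]
    exact ENNReal.mul_ne_top ENNReal.coe_ne_top ENNReal.ofReal_ne_top
  · filter_upwards [hG'] with ω hω z
    rw [← hmul]
    simp only [hω]
  · rw [integral_eq_lintegral_of_nonneg_ae (Eventually.of_forall fun z => (hρpos ω z).le)
      (hρω ω).aestronglyMeasurable, lintegral_withDensity_eq_lintegral_mul _ hm0
      (hρω ω).ennreal_ofReal]
    have : (jointDensity p0 ψ P0 * fun z => ENNReal.ofReal (ρ ω z)) =
        jointDensity p0 ψ fun x => G' x ω := funext fun z => (hmul ω z).symm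
    rw [this, lintegral_jointDensity hp0 hp0_density hψm hψ_density (hG'ω ω), ENNReal.toReal_one]
  · -- compactly supported approximation of the predictor law, and the Kullback–Leibler bound
    have hsnd : MeasurePreserving Prod.snd Q0 (νX.withDensity fun x => p0 x) :=
      ⟨measurable_snd, map_snd_withDensity_jointDensity hp0 hψm hψ_density hP0m⟩
    set μX : Measure X := νX.withDensity fun x => p0 x with hμX
    have hμprob : IsProbabilityMeasure μX := ⟨by
      rw [hμX, withDensity_apply _ MeasurableSet.univ, setLIntegral_univ, hp0_density]⟩
    set e : ℝ := ε * c / (2 * (1 + M)) with he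
    have he0 : 0 < e := by positivity
    obtain ⟨K, hK, hKe⟩ := isTightMeasureSet_iff_exists_isCompact_measure_compl_le.1
      (isTightMeasureSet_singleton (μ := μX)) (ENNReal.ofReal e) (ENNReal.ofReal_pos.2 he0)
    have hKe' : μX.real Kᶜ ≤ e :=
      ENNReal.toReal_le_of_le_ofReal he0.le (hKe μX (Set.mem_singleton _))
    have hKm : MeasurableSet K := hK.measurableSet
    refine (hG.measure_ae_abs_integral_sub_le_pos hθ hV_cont hV_supp hP0 hatoms
      (k := fun y t => (ψ y t : ℝ)) (by fun_prop) hMR.le (fun y t => (ψ y t).coe_nonneg)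
      (fun y t => NNReal.coe_le_coe.2 (hcM (y, t)).2) μX hK he0).trans_le (measure_mono_ae ?_)
    filter_upwards [hG'] with ω hω happ
    change ∀ᵐ x ∂μX, _ at happ
    change ∫ z, -Real.log (ρ ω z) ∂Q0 < ε
    -- `-log ρ ≤ 1 / ρ - 1` bounds the divergence by a multiple of the `L¹` distance
    have hlog (z : Y × X) : -Real.log (ρ ω z) ≤ |I (G' z.2 ω) z.1 - I (P0 z.2) z.1| / c := by
      have h1 := Real.one_sub_inv_le_log_of_pos (hρpos ω z)
      have h2 : (ρ ω z)⁻¹ - 1 = (I (P0 z.2) z.1 - I (G' z.2 ω) z.1) / I (G' z.2 ω) z.1 := by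
        have := (hIpos (G' z.2 ω) z.1).ne'
        simp only [ρ, inv_div]
        field_simp
      have h3 : (I (P0 z.2) z.1 - I (G' z.2 ω) z.1) / I (G' z.2 ω) z.1 ≤
          |I (G' z.2 ω) z.1 - I (P0 z.2) z.1| / c := by
        rw [abs_sub_comm]
        exact div_le_div₀ (abs_nonneg _) (le_abs_self _) hcR (hI _ _).2.1
      linarith
    have hbound : ∀ᵐ z ∂Q0, -Real.log (ρ ω z) ≤
        e / c + (Prod.snd ⁻¹' Kᶜ).indicator (fun _ => (M : ℝ) / c) z := by
      filter_upwards [hsnd.quasiMeasurePreserving.ae happ] with z hz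
      refine (hlog z).trans ?_
      by_cases hzK : z.2 ∈ K
      · have h4 := hz hzK z.1
        rw [← hω] at h4
        rw [Set.indicator_of_notMem (by simpa using hzK), add_zero]
        exact div_le_div_of_nonneg_right h4 hcR.le
      · rw [Set.indicator_of_mem (by simpa using hzK)]
        have h5 : |I (G' z.2 ω) z.1 - I (P0 z.2) z.1| ≤ M := by
          have h6 := (hI (G' z.2 ω) z.1).2.2
          have h7 := (hI (P0 z.2) z.1).2.2
          have h8 := hIpos (G' z.2 ω) z.1
          have h9 := hIpos (P0 z.2) z.1
          rw [abs_le]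
          constructor <;> linarith
        have h10 := div_le_div_of_nonneg_right h5 hcR.le
        linarith [div_nonneg he0.le hcR.le]
    have hpre : MeasurableSet (Prod.snd ⁻¹' Kᶜ : Set (Y × X)) := measurable_snd hKm.compl
    have hind : Integrable ((Prod.snd ⁻¹' Kᶜ).indicator fun _ : Y × X => (M : ℝ) / c) Q0 :=
      (integrable_const _).indicator hpre
    have hlogi : Integrable (fun z => -Real.log (ρ ω z)) Q0 := by
      refine Integrable.of_bound (hρω ω).log.neg.aestronglyMeasurable
        (max (Real.log ((M : ℝ) / c)) (-Real.log ((c : ℝ) / M))) (Eventually.of_forall fun z => ?_)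
      have h1 := Real.log_le_log (div_pos hcR hMR) (hρa ω z)
      have h2 := Real.log_le_log (hρpos ω z) (hρb ω z)
      rw [Real.norm_eq_abs, abs_neg, abs_le]
      constructor
      · linarith [le_max_right (Real.log ((M : ℝ) / c)) (-Real.log ((c : ℝ) / M))]
      · exact h2.trans (le_max_left _ _)
    calc ∫ z, -Real.log (ρ ω z) ∂Q0
        ≤ ∫ z, (e / c + (Prod.snd ⁻¹' Kᶜ).indicator (fun _ => (M : ℝ) / c) z) ∂Q0 :=
          integral_mono_ae hlogi ((integrable_const _).add hind) hbound
      _ = e / c + μX.real Kᶜ * (M / c) := by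
          rw [integral_add (integrable_const _) hind, integral_indicator_const _ hpre,
            integral_const, probReal_univ, one_smul, smul_eq_mul, measureReal_def,
            hsnd.measure_preimage hKm.compl.nullMeasurableSet, measureReal_def]
      _ ≤ e / c + e * (M / c) := by gcongr
      _ = ε / 2 := by rw [he]; field_simp
      _ < ε := by linarith

end DepDirichlet

theorem mainTheorem12
    {X Y Θ Ω : Type*}
    [TopologicalSpace X] [PolishSpace X] [MeasurableSpace X] [BorelSpace X]
    [TopologicalSpace Y] [PolishSpace Y] [MeasurableSpace Y] [BorelSpace Y] [CompactSpace Y]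
    [TopologicalSpace Θ] [PolishSpace Θ] [MeasurableSpace Θ] [BorelSpace Θ]
    [MeasurableSpace Ω] (P : Measure Ω) [IsProbabilityMeasure P]
    -- the kernel of the mixture
    (νY : Measure Y) (ψ : Y → Θ → ℝ≥0)
    (hψ_cont : Continuous fun p : Y × Θ => ψ p.1 p.2)
    (hψ_pos : ∀ y t, 0 < ψ y t)
    (hψ_density : ∀ t, ∫⁻ y, ψ y t ∂νY = 1)
    (hψ_decay : DepDirichlet.DecaysInParameter ψ)
    -- the density of the predictors
    (νX : Measure X) [SFinite νX] (p0 : X → ℝ≥0) (hp0 : Measurable p0)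
    (hp0_density : ∫⁻ x, p0 x ∂νX = 1)
    -- the true mixing measures
    (P0 : X → ProbabilityMeasure Θ) (hP0 : DepDirichlet.StronglyContinuous P0)
    -- the process, with its stick processes
    (V : ℕ → X → Ω → ℝ) (α : X → ℝ≥0) (G : X → Ω → ProbabilityMeasure Θ)
    (hV_cont : ∀ i, ∀ᵐ ω ∂P, Continuous fun x => V i x ω)
    (hV_supp : ∀ ε : ℝ, 0 < ε → ∀ h : X → ℝ, Continuous h → (∀ x, h x ∈ Set.Icc (0 : ℝ) 1) →
      ∀ K : Set X, IsCompact K → 0 < P {ω | ∀ x ∈ K, |V 0 x ω - h x| < ε})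
    (hG :
      (∃ (θ : ℕ → Ω → Θ) (G0 : ProbabilityMeasure Θ),
        DepDirichlet.IsThetaDDP P V α θ G0 G ∧ (G0 : Measure Θ).IsOpenPosMeasure) ∨
      (∃ (θ : ℕ → X → Ω → Θ) (G0 : X → ProbabilityMeasure Θ),
        DepDirichlet.IsDDP P V α θ G0 G ∧
        (∀ i, DepDirichlet.IsJointlyMeasurable P (θ i)) ∧
        (DepDirichlet.AtomsVisitOpenSets P θ ∨
          (DepDirichlet.AtomsVisitPositiveSets P θ G0 ∧
            ∀ x, (P0 x : Measure Θ) ≪ (G0 x : Measure Θ))))) :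
    DepDirichlet.WeaklyConsistentAt (νY.prod νX) P
      (fun ω => DepDirichlet.jointDensity p0 ψ fun x => G x ω)
      (DepDirichlet.jointDensity p0 ψ P0) := by
  have hX : Nonempty X := by
    by_contra h
    rw [not_nonempty_iff] at h
    simp at hp0_density
  have hΘ : Nonempty Θ := (P0 hX.some).nonempty
  have hνY : IsFiniteMeasure νY :=
    DepDirichlet.isFiniteMeasure_of_lintegral_kernel_eq_one hψ_cont hψ_pos (hψ_density hΘ.some)
  have hΘc : CompactSpace Θ := hψ_decay.compactSpace hψ_density
  -- in the single-atoms case the constant atom processes visit open sets by full support of `G0`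
  rcases hG with ⟨θ, G0, hG, hG0⟩ | ⟨θ, G0, hG, hθ, hatoms⟩
  · refine hG.isDDP.weaklyConsistentAt hψ_cont hψ_pos hψ_density hp0 hp0_density hP0
      (fun i => ⟨fun _ ω => θ i ω, (hG.atoms_measurable i).comp measurable_snd,
        Eventually.of_forall fun _ _ => rfl⟩) hV_cont hV_supp (Or.inl fun U hU hUn K _ => ?_)
    have hpos : 0 < P (θ 0 ⁻¹' U) := by
      rw [← Measure.map_apply (hG.atoms_measurable 0) hU.measurableSet, hG.atoms_law 0]
      exact hU.measure_pos _ hUn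
    exact hpos.trans_le (measure_mono fun ω hω x _ => hω)
  · exact hG.weaklyConsistentAt hψ_cont hψ_pos hψ_density hp0 hp0_density hP0 hθ hV_cont hV_supp
      hatoms
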